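/- Let $(M,g)$ be any smooth Riemannian manifold of dimension $d$, let $\widetilde M=\mathbb R\times M$ carry the Lorentz metric $\eta=\mathrm{diag}(-1,g)$, and let $(N,h)$ be a smooth Riemannian manifold of dimension $n$. Let $u:\widetilde M\to N$ be a smooth wave map, i.e. a smooth map with $$\frac1{\sqrt{|\eta|}}\,D_\alpha\big(\sqrt{|\eta|}\,\eta^{\alpha\beta}\partial_\beta u\big)=0$$ in local coordinates, where $D$ is the pull-back covariant derivative on $u^*TN$. Let $e=(e_1,\dots,e_n)$ be a smooth orthonormal frame of $u^*TN$ over $\widetilde M$ (for instance the Coulomb frame, that is, the orthonormal frame whose connection form on each time slice $\{s\}\times M$ has the least $L^2$ norm). Write $du=q^ae_a$ with the scalar $1$-forms $q^a=q^a_\alpha dx^\alpha$, $q^a_\alpha=u^*h(\partial_\alpha u,e_a)$. Let $A=(A^b_a)$ be the connection form of $e$, $D_\alpha e_a=A^b_{a,\alpha}e_b$, and let $F$ be the curvature of $D$ on $u^*TN$ in the frame $e$, $(D_\alpha D_\beta-D_\beta D_\alpha)e_a=F^b_{a,\alpha\beta}e_b$. Let $\nabla$ be the Levi-Civita connection of $(\widetilde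 M,\eta)$, acting on the scalar $1$-forms $q^a$ and $A^b_a$, and $\nabla^\alpha=\eta^{\alpha\beta}\nabla_\beta$. Then in all local coordinates $(x^0=t,x^1,\dots,x^d)$ on $\widetilde M$ given by a chart of $M$, and for every space-time index $0\le\gamma\le d$, the components of $q$ satisfy $$\ddot q_\gamma-\Delta_g q_\gamma+2g^{ij}\Gamma^k_{j\gamma}\partial_iq_k+\partial_\gamma(g^{ij}\Gamma^k_{ij})\,q_k =F_{\gamma\alpha}q^\alpha+A_\alpha A^\alpha q_\gamma+(\nabla^\alpha A)_\alpha q_\gamma+2A^\alpha(\nabla_\alpha q)_\gamma .$$ Here $q=(q^1,\dots,q^n)$ is acted on by the matrices $A_\alpha$, $F_{\alpha\beta}$; Greek indices run over $0,\dots,d$ and are raised with $\eta$; Latin indices $i,j,k$ run over $1,\dots,d$; $\Gamma$ are the Christoffel symbols of $g$ (those of $\eta$, which vanish if one of the indices is $0$); $\Delta_gf=|g|^{-1/2}\partial_i(|g|^{1/2}g^{ij}\partial_jf)$ is applied to each component $q^a_\gamma$ as to a scalar function. Moreover the left-hand side equals $$\ddot q_\gamma-g^{ij}\partial_i\partial_jq_\gamma+g^{ij}\Gamma^k_{ij}\partial_kq_\gamma+2g^{ij}\Gamma^k_{j\gamma}\partial_iq_k+\partial_\gamma(g^{ij}\Gamma^k_{ij})\,q_k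 .$$ -/

import Mathlib

open scoped Manifold ContDiff

noncomputable section

namespace WaveMap

/-- Directional derivative of a real function; with `v` a coordinate vector this is `∂_v f`. -/
def pd {X : Type*} [NormedAddCommGroup X] [NormedSpace ℝ X] (v : X) (f : X → ℝ) (x : X) : ℝ :=
  fderiv ℝ f x v

/-- The coordinate directions of `ℝ × ℝ^d`: index `0` is time, index `i.succ` is the `i`-th
space direction. -/
def dir (d : ℕ) : Fin (d + 1) → ℝ × EuclideanSpace ℝ (Fin d) :=
  Fin.cons (1, 0) (fun i => (0, EuclideanSpace.single i 1))

/-- Christoffel symbols `Γ^k_{ij} = ½ G^{km} (∂_i G_{mj} + ∂_j G_{im} - ∂_m G_{ij})` of a field of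
(pseudo-)metric coefficients `G`, where `∂_i` is the derivative in the direction `b i`. -/
def christoffel {ι X : Type*} [Fintype ι] [DecidableEq ι] [NormedAddCommGroup X]
    [NormedSpace ℝ X] (b : ι → X) (G : X → Matrix ι ι ℝ) (k i j : ι) (x : X) : ℝ :=
  (1 / 2) * ∑ m, (G x)⁻¹ k m *
    (pd (b i) (fun y => G y m j) x + pd (b j) (fun y => G y i m) x
      - pd (b m) (fun y => G y i j) x)

section Domain

variable {d : ℕ} {M : Type*} [TopologicalSpace M] [ChartedSpace (EuclideanSpace ℝ (Fin d)) M]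
  [IsManifold (𝓡 d) ∞ M]

/-- Smooth Riemannian metrics on the manifold `M`. -/
abbrev RiemMetric (d : ℕ) (M : Type*) [TopologicalSpace M]
    [ChartedSpace (EuclideanSpace ℝ (Fin d)) M] [IsManifold (𝓡 d) ∞ M] :=
  Bundle.ContMDiffRiemannianMetric (𝓡 d) ∞ (EuclideanSpace ℝ (Fin d))
    (fun x : M => TangentSpace (𝓡 d) x)

/-- The coefficients `g_{ij} = g(∂_i, ∂_j)` in the chart `φ`, as functions of the coordinates. -/
def metricCoeff (g : RiemMetric d M) (φ : OpenPartialHomeomorph M (EuclideanSpace ℝ (Fin d)))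
    (y : EuclideanSpace ℝ (Fin d)) : Matrix (Fin d) (Fin d) ℝ :=
  Matrix.of fun i j => g.inner (φ.symm y)
    (mfderiv (𝓡 d) (𝓡 d) φ.symm y (EuclideanSpace.single i (1 : ℝ)))
    (mfderiv (𝓡 d) (𝓡 d) φ.symm y (EuclideanSpace.single j (1 : ℝ)))

/-- The coefficients of the Lorentz metric `η = diag(-1, g_{ij})` of `ℝ × M` in the coordinates
`(t, φ)`. -/
def lorentzCoeff (g : RiemMetric d M) (φ : OpenPartialHomeomorph M (EuclideanSpace ℝ (Fin d)))
    (p : ℝ × EuclideanSpace ℝ (Fin d)) : Matrix (Fin (d + 1)) (Fin (d + 1)) ℝ :=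
  Matrix.of (Fin.cons (Fin.cons (-1) 0) (fun i => Fin.cons 0 (metricCoeff g φ p.2 i)))

/-- Christoffel symbols `Γ^σ_{αβ}` of `η` in the coordinates `(t, φ)`. They vanish when one of the
indices is `0`, and for space indices they are the Christoffel symbols of `g`. -/
def stChristoffel (g : RiemMetric d M) (φ : OpenPartialHomeomorph M (EuclideanSpace ℝ (Fin d)))
    (σ α β : Fin (d + 1)) (p : ℝ × EuclideanSpace ℝ (Fin d)) : ℝ :=
  christoffel (dir d) (lorentzCoeff g φ) σ α β p

/-- `(∇_β θ)_α = ∂_β θ_α - Γ^σ_{βα} θ_σ` for a scalar 1-form `θ = θ_α dx^α` on `ℝ × M`. -/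
def nabla (g : RiemMetric d M) (φ : OpenPartialHomeomorph M (EuclideanSpace ℝ (Fin d)))
    (θ : Fin (d + 1) → ℝ × EuclideanSpace ℝ (Fin d) → ℝ) (β α : Fin (d + 1))
    (p : ℝ × EuclideanSpace ℝ (Fin d)) : ℝ :=
  pd (dir d β) (θ α) p - ∑ σ, stChristoffel g φ σ β α p * θ σ p

/-- The Laplace-Beltrami operator of `(M, g)` on functions of `(t, x)`, in coordinates:
`Δ_g f = |g|^{-1/2} ∂_i (|g|^{1/2} g^{ij} ∂_j f)`. -/
def laplaceBeltrami (g : RiemMetric d M)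
    (φ : OpenPartialHomeomorph M (EuclideanSpace ℝ (Fin d)))
    (f : ℝ × EuclideanSpace ℝ (Fin d) → ℝ) (p : ℝ × EuclideanSpace ℝ (Fin d)) : ℝ :=
  (1 / Real.sqrt |(metricCoeff g φ p.2).det|) *
    ∑ i : Fin d, pd (dir d i.succ) (fun p' => Real.sqrt |(metricCoeff g φ p'.2).det| *
      ∑ j : Fin d, (metricCoeff g φ p'.2)⁻¹ i j * pd (dir d j.succ) f p') p

/-- The lower order terms `2 g^{ij} Γ^k_{jγ} ∂_i θ_k + ∂_γ(g^{ij} Γ^k_{ij}) θ_k`, where `i, j, k`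
are space indices and `γ` is a space-time index. -/
def lowerOrder (g : RiemMetric d M) (φ : OpenPartialHomeomorph M (EuclideanSpace ℝ (Fin d)))
    (θ : Fin (d + 1) → ℝ × EuclideanSpace ℝ (Fin d) → ℝ) (γ : Fin (d + 1))
    (p : ℝ × EuclideanSpace ℝ (Fin d)) : ℝ :=
  2 * (∑ i : Fin d, ∑ j : Fin d, ∑ k : Fin d, (metricCoeff g φ p.2)⁻¹ i j *
      stChristoffel g φ k.succ j.succ γ p * pd (dir d i.succ) (θ k.succ) p)
  + ∑ k : Fin d, pd (dir d γ) (fun p' => ∑ i : Fin d, ∑ j : Fin d,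
      (metricCoeff g φ p'.2)⁻¹ i j * stChristoffel g φ k.succ i.succ j.succ p') p * θ k.succ p

/-- `θ̈_γ - Δ_g θ_γ + 2 g^{ij} Γ^k_{jγ} ∂_i θ_k + ∂_γ(g^{ij} Γ^k_{ij}) θ_k`. -/
def waveLHS (g : RiemMetric d M) (φ : OpenPartialHomeomorph M (EuclideanSpace ℝ (Fin d)))
    (θ : Fin (d + 1) → ℝ × EuclideanSpace ℝ (Fin d) → ℝ) (γ : Fin (d + 1))
    (p : ℝ × EuclideanSpace ℝ (Fin d)) : ℝ :=
  pd (dir d 0) (pd (dir d 0) (θ γ)) p - laplaceBeltrami g φ (θ γ) p + lowerOrder g φ θ γ p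

/-- `θ̈_γ - g^{ij} ∂_i ∂_j θ_γ + g^{ij} Γ^k_{ij} ∂_k θ_γ + 2 g^{ij} Γ^k_{jγ} ∂_i θ_k
+ ∂_γ(g^{ij} Γ^k_{ij}) θ_k`. -/
def waveLHSExpanded (g : RiemMetric d M)
    (φ : OpenPartialHomeomorph M (EuclideanSpace ℝ (Fin d)))
    (θ : Fin (d + 1) → ℝ × EuclideanSpace ℝ (Fin d) → ℝ) (γ : Fin (d + 1))
    (p : ℝ × EuclideanSpace ℝ (Fin d)) : ℝ :=
  pd (dir d 0) (pd (dir d 0) (θ γ)) p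
  - (∑ i : Fin d, ∑ j : Fin d, (metricCoeff g φ p.2)⁻¹ i j *
      pd (dir d i.succ) (pd (dir d j.succ) (θ γ)) p)
  + (∑ i : Fin d, ∑ j : Fin d, ∑ k : Fin d, (metricCoeff g φ p.2)⁻¹ i j *
      stChristoffel g φ k.succ i.succ j.succ p * pd (dir d k.succ) (θ γ) p)
  + lowerOrder g φ θ γ p

end Domain

section Maps

variable {d n : ℕ} {M : Type*} [TopologicalSpace M]
  [ChartedSpace (EuclideanSpace ℝ (Fin d)) M] [IsManifold (𝓡 d) ∞ M]
  {N : Type*} [TopologicalSpace N] [ChartedSpace (EuclideanSpace ℝ (Fin n)) N]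
  [IsManifold (𝓡 n) ∞ N]

/-- The map `u` read in the coordinates `(t, φ)` of `ℝ × M`, with values in `N`. -/
def pull (u : ℝ × M → N) (φ : OpenPartialHomeomorph M (EuclideanSpace ℝ (Fin d)))
    (p : ℝ × EuclideanSpace ℝ (Fin d)) : N :=
  u (p.1, φ.symm p.2)

/-- The coordinates where both charts are usable: `x = φ⁻¹(y)` makes sense and `u(t, x)` lies in
the domain of the chart `ψ` of `N`. -/
def coordDomain (u : ℝ × M → N) (φ : OpenPartialHomeomorph M (EuclideanSpace ℝ (Fin d)))
    (ψ : OpenPartialHomeomorph N (EuclideanSpace ℝ (Fin n))) :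
    Set (ℝ × EuclideanSpace ℝ (Fin d)) :=
  {p | p.2 ∈ φ.target ∧ pull u φ p ∈ ψ.source}

/-- `∂_α u^k`, the components of `∂_α u` in the chart `ψ`. -/
def du (u : ℝ × M → N) (φ : OpenPartialHomeomorph M (EuclideanSpace ℝ (Fin d)))
    (ψ : OpenPartialHomeomorph N (EuclideanSpace ℝ (Fin n))) (α : Fin (d + 1))
    (p : ℝ × EuclideanSpace ℝ (Fin d)) (k : Fin n) : ℝ :=
  pd (dir d α) (fun p' => ψ (pull u φ p') k) p

/-- The pull-back covariant derivative on `u^*TN` (of the Levi-Civita connection of `h`), in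
coordinates: `(D_α V)^k = ∂_α V^k + Γ^k_{ij}(u) ∂_α u^i V^j`, where the section `V` of `u^*TN` is
given by its components `V^k` in the chart `ψ`. -/
def covD (h : RiemMetric n N) (u : ℝ × M → N)
    (φ : OpenPartialHomeomorph M (EuclideanSpace ℝ (Fin d)))
    (ψ : OpenPartialHomeomorph N (EuclideanSpace ℝ (Fin n))) (α : Fin (d + 1))
    (V : ℝ × EuclideanSpace ℝ (Fin d) → Fin n → ℝ) (p : ℝ × EuclideanSpace ℝ (Fin d))
    (k : Fin n) : ℝ :=
  pd (dir d α) (fun p' => V p' k) p +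
    ∑ i, ∑ j, christoffel (fun i : Fin n => EuclideanSpace.single i (1 : ℝ)) (metricCoeff h ψ)
      k i j (ψ (pull u φ p)) * du u φ ψ α p i * V p j

/-- `u` is a smooth wave map: it is smooth and `|η|^{-1/2} D_α(|η|^{1/2} η^{αβ} ∂_β u) = 0` in all
local coordinates. -/
structure IsSmoothWaveMap (g : RiemMetric d M) (h : RiemMetric n N) (u : ℝ × M → N) : Prop where
  smooth : ContMDiff (𝓘(ℝ, ℝ).prod (𝓡 d)) (𝓡 n) ∞ u
  eq : ∀ φ ∈ IsManifold.maximalAtlas (𝓡 d) ∞ M, ∀ ψ ∈ IsManifold.maximalAtlas (𝓡 n) ∞ N,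
    ∀ p ∈ coordDomain u φ ψ, ∀ k : Fin n,
      (1 / Real.sqrt |(lorentzCoeff g φ p).det|) *
        ∑ α, covD h u φ ψ α (fun p' l => Real.sqrt |(lorentzCoeff g φ p').det| *
          ∑ β, (lorentzCoeff g φ p')⁻¹ α β * du u φ ψ β p' l) p k = 0

/-- `e = (e_1, …, e_n)` is a smooth orthonormal frame of `u^*TN` over `ℝ × M`. -/
structure IsOrthonormalFrame (h : RiemMetric n N) (u : ℝ × M → N)
    (e : Fin n → (z : ℝ × M) → TangentSpace (𝓡 n) (u z)) : Prop where
  smooth : ∀ a, ContMDiff (𝓘(ℝ, ℝ).prod (𝓡 d)) (𝓡 n).tangent ∞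
    (fun z => (⟨u z, e a z⟩ : TangentBundle (𝓡 n) N))
  orthonormal : ∀ a b z, h.inner (u z) (e a z) (e b z) = if a = b then 1 else 0

/-- `q^a_α = u^*h(∂_α u, e_a)`, so that `du = q^a e_a` with `q^a = q^a_α dx^α`. -/
def q (h : RiemMetric n N) (u : ℝ × M → N) (e : Fin n → (z : ℝ × M) → TangentSpace (𝓡 n) (u z))
    (φ : OpenPartialHomeomorph M (EuclideanSpace ℝ (Fin d))) (a : Fin n) (α : Fin (d + 1))
    (p : ℝ × EuclideanSpace ℝ (Fin d)) : ℝ :=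
  h.inner (pull u φ p)
    (mfderiv 𝓘(ℝ, ℝ × EuclideanSpace ℝ (Fin d)) (𝓡 n) (pull u φ) p (dir d α))
    (e a (p.1, φ.symm p.2))

/-- The components `e_a^k` of the frame in the chart `ψ`. -/
def frameCoord (u : ℝ × M → N) (e : Fin n → (z : ℝ × M) → TangentSpace (𝓡 n) (u z))
    (φ : OpenPartialHomeomorph M (EuclideanSpace ℝ (Fin d)))
    (ψ : OpenPartialHomeomorph N (EuclideanSpace ℝ (Fin n))) (a : Fin n)
    (p : ℝ × EuclideanSpace ℝ (Fin d)) (k : Fin n) : ℝ :=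
  let v : EuclideanSpace ℝ (Fin n) := mfderiv (𝓡 n) (𝓡 n) ψ (pull u φ p) (e a (p.1, φ.symm p.2))
  v k

/-- The inner product `u^*h(V, W)` of two sections of `u^*TN` given by components in `ψ`. -/
def pair (h : RiemMetric n N) (u : ℝ × M → N)
    (φ : OpenPartialHomeomorph M (EuclideanSpace ℝ (Fin d)))
    (ψ : OpenPartialHomeomorph N (EuclideanSpace ℝ (Fin n)))
    (p : ℝ × EuclideanSpace ℝ (Fin d)) (V W : Fin n → ℝ) : ℝ :=
  ∑ k, ∑ l, metricCoeff h ψ (ψ (pull u φ p)) k l * V k * W l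

/-- The connection form `A^b_{a,α} = u^*h(D_α e_a, e_b)` of the frame, i.e. `D_α e_a = A^b_{a,α} e_b`;
the argument order is `b a α`. Its value does not depend on the chart `ψ` of `N`. -/
def connA (h : RiemMetric n N) (u : ℝ × M → N)
    (e : Fin n → (z : ℝ × M) → TangentSpace (𝓡 n) (u z))
    (φ : OpenPartialHomeomorph M (EuclideanSpace ℝ (Fin d)))
    (ψ : OpenPartialHomeomorph N (EuclideanSpace ℝ (Fin n))) (b a : Fin n) (α : Fin (d + 1))
    (p : ℝ × EuclideanSpace ℝ (Fin d)) : ℝ :=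
  pair h u φ ψ p (covD h u φ ψ α (frameCoord u e φ ψ a) p) (frameCoord u e φ ψ b p)

/-- The curvature of the pull-back connection on `u^*TN` in the frame:
`F^b_{a,αβ} = u^*h((D_α D_β - D_β D_α) e_a, e_b)`; the argument order is `b a α β`. -/
def curvF (h : RiemMetric n N) (u : ℝ × M → N)
    (e : Fin n → (z : ℝ × M) → TangentSpace (𝓡 n) (u z))
    (φ : OpenPartialHomeomorph M (EuclideanSpace ℝ (Fin d)))
    (ψ : OpenPartialHomeomorph N (EuclideanSpace ℝ (Fin n))) (b a : Fin n)
    (α β : Fin (d + 1)) (p : ℝ × EuclideanSpace ℝ (Fin d)) : ℝ :=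
  pair h u φ ψ p
    (fun k => covD h u φ ψ α (covD h u φ ψ β (frameCoord u e φ ψ a)) p k
      - covD h u φ ψ β (covD h u φ ψ α (frameCoord u e φ ψ a)) p k)
    (frameCoord u e φ ψ b p)

/-- The `c`-th frame component of
`F_{γα} q^α + A_α A^α q_γ + (∇^α A)_α q_γ + 2 A^α (∇_α q)_γ`, indices being raised with `η` and
`A_α`, `F_{αβ}` acting as matrices on the frame components. -/
def waveRHS (g : RiemMetric d M) (h : RiemMetric n N) (u : ℝ × M → N)
    (e : Fin n → (z : ℝ × M) → TangentSpace (𝓡 n) (u z))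
    (φ : OpenPartialHomeomorph M (EuclideanSpace ℝ (Fin d)))
    (ψ : OpenPartialHomeomorph N (EuclideanSpace ℝ (Fin n))) (c : Fin n) (γ : Fin (d + 1))
    (p : ℝ × EuclideanSpace ℝ (Fin d)) : ℝ :=
  ∑ α, ∑ β, (lorentzCoeff g φ p)⁻¹ α β *
    ((∑ a, curvF h u e φ ψ c a γ α p * q h u e φ a β p)
      + (∑ b, ∑ a, connA h u e φ ψ c b α p * connA h u e φ ψ b a β p * q h u e φ a γ p)
      + (∑ a, nabla g φ (connA h u e φ ψ c a) β α p * q h u e φ a γ p)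
      + 2 * ∑ a, connA h u e φ ψ c a β p * nabla g φ (q h u e φ a) α γ p)

end Maps

end WaveMap

end

/-! Read in the frame, the covariant derivative of `du` is D_α q_β = ∂_α q_β + A_α q_β
(`pair_covD_du`); metric compatibility and orthonormality make A skew-symmetric, and the curvature
is F = dA + A ∧ A (`curvF_eq`). Two first-order equations carry everything. The pull-back connection
is torsion free, so D_α q_β = D_β q_α (`frame_closed`). The wave map equation says η^{αβ} D_α q_β =
Λ^σ q_σ with Λ^σ = η^{μν} Γ^σ_{μν} (`frame_coclosed`); here Λ appears because ∂_α(√|η| η^{αβ}) =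
-√|η| Λ^β (`sum_pd_sqrt_det_mul_inv`).

Apply D_γ to the second equation. Exchanging ∂_γ and ∂_α and using the first equation turns ∂_γ q_β
into ∂_β q_γ plus connection terms; the exchange leaves F_{γα} q^α behind. The derivative ∂_γ
η^{αβ}, expressed through Christoffel symbols, gives the term 2 η^{αβ} Γ^σ_{βγ} ∂_α q_σ, and ∂_γ Λ^σ
gives the zeroth-order term. The remaining connection terms are those of the right-hand side.

The index algebra is `wave_algebra`; `wave_equation_of_closed_of_coclosed` feeds calculus into it
for an arbitrary non-degenerate symmetric metric. The block form diag(-1, g) then splits time from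
space (`waveLHSExpanded_eq`), and `laplaceBeltrami_eq` identifies the two forms of the left-hand
side. -/

set_option linter.unusedSectionVars false

noncomputable section

namespace WaveMap

/-! ### Directional derivatives of smooth functions. -/

section Calculus

variable {X : Type*} [NormedAddCommGroup X] [NormedSpace ℝ X]

lemma pd_congr {v : X} {f f' : X → ℝ} {x : X} (h : f =ᶠ[nhds x] f') : pd v f x = pd v f' x := by
  unfold pd; rw [h.fderiv_eq]

lemma pd_const (v : X) (a : ℝ) (x : X) : pd v (fun _ => a) x = 0 := by
  simp [pd]

lemma pd_add {v : X} {f f' : X → ℝ} {x : X} (hf : DifferentiableAt ℝ f x)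
    (hf' : DifferentiableAt ℝ f' x) :
    pd v (fun y => f y + f' y) x = pd v f x + pd v f' x := by
  unfold pd; rw [fderiv_fun_add hf hf']; rfl

lemma pd_sub {v : X} {f f' : X → ℝ} {x : X} (hf : DifferentiableAt ℝ f x)
    (hf' : DifferentiableAt ℝ f' x) :
    pd v (fun y => f y - f' y) x = pd v f x - pd v f' x := by
  unfold pd; rw [fderiv_fun_sub hf hf']; rfl

lemma pd_neg {v : X} {f : X → ℝ} {x : X} : pd v (fun y => - f y) x = - pd v f x := by
  unfold pd; rw [fderiv_fun_neg]; rfl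

lemma pd_mul {v : X} {f f' : X → ℝ} {x : X} (hf : DifferentiableAt ℝ f x)
    (hf' : DifferentiableAt ℝ f' x) :
    pd v (fun y => f y * f' y) x = pd v f x * f' x + f x * pd v f' x := by
  unfold pd; rw [fderiv_fun_mul hf hf']; simp; ring

lemma pd_sum {ι : Type*} {s : Finset ι} {v : X} {f : ι → X → ℝ} {x : X}
    (hf : ∀ i ∈ s, DifferentiableAt ℝ (f i) x) :
    pd v (fun y => ∑ i ∈ s, f i y) x = ∑ i ∈ s, pd v (f i) x := by
  unfold pd; rw [fderiv_fun_sum hf]; simp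

lemma pd_prod {ι : Type*} [DecidableEq ι] {s : Finset ι} {v : X} {f : ι → X → ℝ} {x : X}
    (hf : ∀ i ∈ s, DifferentiableAt ℝ (f i) x) :
    pd v (fun y => ∏ i ∈ s, f i y) x = ∑ i ∈ s, (∏ j ∈ s.erase i, f j x) * pd v (f i) x := by
  unfold pd; rw [fderiv_finsetProd hf]; simp

lemma _root_.ContDiffAt.pd {v : X} {f : X → ℝ} {x : X} (hf : ContDiffAt ℝ ∞ f x) :
    ContDiffAt ℝ ∞ (WaveMap.pd v f) x :=
  (hf.fderiv_right (m := ∞) (by simp)).clm_apply contDiffAt_const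

lemma _root_.ContDiffAt.diff {F : Type*} [NormedAddCommGroup F] [NormedSpace ℝ F] {f : X → F}
    {x : X} (hf : ContDiffAt ℝ ∞ f x) : DifferentiableAt ℝ f x :=
  hf.differentiableAt (by simp)

lemma pd_comm {v w : X} {f : X → ℝ} {x : X} (hf : ContDiffAt ℝ ∞ f x) :
    pd v (pd w f) x = pd w (pd v f) x := by
  have h := (hf.isSymmSndFDerivAt (by simp; exact WithTop.coe_le_coe.2 le_top)) v w
  have hd : DifferentiableAt ℝ (fderiv ℝ f) x := (hf.fderiv_right (m := ∞) (by simp)).diff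
  have key : ∀ a b : X, pd a (pd b f) x = fderiv ℝ (fderiv ℝ f) x a b := by
    intro a b
    unfold pd
    rw [fderiv_clm_apply hd (differentiableAt_const b)]
    simp
  rw [key, key, h]

/-- The absolute value is needed because a Lorentz metric has negative determinant; the sign of `f`
is constant near `x`, so both cases reduce to the square root of a positive function. -/
lemma pd_sqrt_abs {v : X} {f : X → ℝ} {x : X} (hf : DifferentiableAt ℝ f x) (h0 : f x ≠ 0) :
    pd v (fun y => Real.sqrt |f y|) x = Real.sqrt |f x| * ((1 / 2) * (pd v f x / f x)) := by
  have aux : ∀ f' : X → ℝ, DifferentiableAt ℝ f' x → 0 < f' x →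
      pd v (fun y => Real.sqrt (f' y)) x = Real.sqrt (f' x) * ((1 / 2) * (pd v f' x / f' x)) := by
    intro f' hf' h'
    unfold pd
    rw [fderiv_sqrt hf' h'.ne']
    have hs : Real.sqrt (f' x) ≠ 0 := (Real.sqrt_pos.2 h').ne'
    have h2 : Real.sqrt (f' x) * Real.sqrt (f' x) = f' x := Real.mul_self_sqrt h'.le
    simp only [FunLike.coe_smul, Pi.smul_apply, smul_eq_mul]
    field_simp
    rw [pow_two, h2, mul_comm]
  rcases lt_or_gt_of_ne h0 with h | h
  · have he : (fun y => Real.sqrt |f y|) =ᶠ[nhds x] fun y => Real.sqrt (- f y) := by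
      filter_upwards [hf.continuousAt.eventually_lt continuousAt_const h] with y hy
      rw [abs_of_neg hy]
    rw [pd_congr he, aux (fun y => - f y) hf.neg (by simpa using h), abs_of_neg h, pd_neg]
    simp [neg_div_neg_eq]
  · have he : (fun y => Real.sqrt |f y|) =ᶠ[nhds x] fun y => Real.sqrt (f y) := by
      filter_upwards [continuousAt_const.eventually_lt hf.continuousAt h] with y hy
      rw [abs_of_pos hy]
    rw [pd_congr he, aux _ hf h, abs_of_pos h]

lemma contDiffAt_sqrt_abs {f : X → ℝ} {x : X} (hf : ContDiffAt ℝ ∞ f x) (h0 : f x ≠ 0) :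
    ContDiffAt ℝ ∞ (fun y => Real.sqrt |f y|) x :=
  (hf.abs h0).sqrt (abs_ne_zero.2 h0)

lemma pd_apply_euclidean {n : ℕ} {w : X → EuclideanSpace ℝ (Fin n)} {x : X}
    (hw : DifferentiableAt ℝ w x) (v : X) (k : Fin n) :
    pd v (fun y => w y k) x = (fderiv ℝ w x v) k := by
  have h := ((EuclideanSpace.proj (𝕜 := ℝ) k).hasFDerivAt.comp x hw.hasFDerivAt).fderiv
  exact congrArg (fun L => L v) h

end Calculus

/-! ### Derivatives of determinants and inverse matrices. -/

section MatrixCalculus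

variable {X : Type*} [NormedAddCommGroup X] [NormedSpace ℝ X] {ι : Type*} [Fintype ι]
  [DecidableEq ι] {G : X → Matrix ι ι ℝ} {x : X}

lemma contDiffAt_det (hG : ∀ i j, ContDiffAt ℝ ∞ (fun y => G y i j) x) :
    ContDiffAt ℝ ∞ (fun y => (G y).det) x := by
  simp only [Matrix.det_apply']
  exact ContDiffAt.sum fun σ _ => contDiffAt_const.mul (contDiffAt_prod fun i _ => hG _ _)

lemma contDiffAt_inv (hG : ∀ i j, ContDiffAt ℝ ∞ (fun y => G y i j) x) (h0 : (G x).det ≠ 0)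
    (i j : ι) : ContDiffAt ℝ ∞ (fun y => (G y)⁻¹ i j) x := by
  -- Cramer's rule makes each entry of the inverse a quotient of determinants, hence smooth.
  have h : (fun y => (G y)⁻¹ i j)
      = fun y => (G y).det⁻¹ * ((G y).updateRow j (Pi.single i 1)).det := by
    ext y
    rw [Matrix.inv_def, Ring.inverse_eq_inv', Matrix.smul_apply, Matrix.adjugate_apply,
      smul_eq_mul]
  rw [h]
  refine ((contDiffAt_det hG).inv h0).mul (contDiffAt_det fun k l => ?_)
  by_cases hk : k = j
  · subst hk; simpa using contDiffAt_const
  · simpa [Matrix.updateRow_ne hk] using hG k l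

/-- Jacobi's formula. -/
lemma pd_det (hG : ∀ i j, DifferentiableAt ℝ (fun y => G y i j) x) (h0 : (G x).det ≠ 0) (v : X) :
    pd v (fun y => (G y).det) x
      = (G x).det * ∑ i, ∑ j, (G x)⁻¹ i j * pd v (fun y => G y j i) x := by
  have hadj : ∀ i j, (G x).det * (G x)⁻¹ i j = ((G x).updateRow j (Pi.single i 1)).det := by
    intro i j
    rw [Matrix.inv_def, Ring.inverse_eq_inv', Matrix.smul_apply, Matrix.adjugate_apply,
      smul_eq_mul, ← mul_assoc, mul_inv_cancel₀ h0, one_mul]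
  have hrow : ∀ j (r : ι → ℝ), ((G x).updateRow j r).det
      = ∑ i, ((G x).updateRow j (Pi.single i 1)).det * r i := by
    intro j r
    have := Matrix.cramer_transpose_apply (G x) r j
    rw [← this, Matrix.cramer_eq_adjugate_mulVec, Matrix.mulVec, dotProduct,
      ← Matrix.adjugate_transpose]
    simp only [ Matrix.transpose_apply, Matrix.adjugate_apply]
  -- The determinant is linear in each row, so its derivative replaces one row at a time; `hrow` and
  -- `hadj` then expand the replaced row through the inverse.
  have hL : pd v (fun y => (G y).det) x
      = ∑ j, ((G x).updateRow j (fun i => pd v (fun y => G y j i) x)).det := by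
    have : (fun y => (G y).det) = fun y => ∑ σ : Equiv.Perm ι,
        ((Equiv.Perm.sign σ : ℤ) : ℝ) * ∏ i, G y i (σ i) := by
      ext y; rw [← Matrix.det_transpose, Matrix.det_apply']; rfl
    have hp : ∀ σ : Equiv.Perm ι, DifferentiableAt ℝ (fun y => ∏ i, G y i (σ i)) x :=
      fun σ => (HasFDerivAt.finsetProd fun i _ => (hG i (σ i)).hasFDerivAt).differentiableAt
    have hd : ∀ σ : Equiv.Perm ι, DifferentiableAt ℝ
        (fun y => ((Equiv.Perm.sign σ : ℤ) : ℝ) * ∏ i, G y i (σ i)) x :=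
      fun σ => (differentiableAt_const _).fun_mul (hp σ)
    rw [this, pd_sum fun σ _ => hd σ]
    have h1 : ∀ σ : Equiv.Perm ι, pd v (fun y => ((Equiv.Perm.sign σ : ℤ) : ℝ) *
        ∏ i, G y i (σ i)) x = ∑ j, ((Equiv.Perm.sign σ : ℤ) : ℝ) *
          ∏ i, ((G x).updateRow j (fun i => pd v (fun y => G y j i) x)) i (σ i) := by
      intro σ
      rw [pd_mul (differentiableAt_const _) (hp σ),
        pd_const, zero_mul, zero_add, pd_prod fun i _ => hG i (σ i), Finset.mul_sum]
      refine Finset.sum_congr rfl fun j _ => ?_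
      rw [← Finset.mul_prod_erase Finset.univ _ (Finset.mem_univ j), Matrix.updateRow_self,
        mul_comm (pd v _ x)]
      congr 2
      exact Finset.prod_congr rfl fun i hi => by
        rw [Matrix.updateRow_ne (Finset.ne_of_mem_erase hi)]
    rw [Finset.sum_congr rfl fun σ _ => h1 σ, Finset.sum_comm]
    refine Finset.sum_congr rfl fun j _ => ?_
    rw [← Matrix.det_transpose, Matrix.det_apply']; rfl
  rw [hL, Finset.sum_congr rfl fun j _ => hrow j _, Finset.sum_comm, Finset.mul_sum]
  refine Finset.sum_congr rfl fun i _ => ?_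
  rw [Finset.mul_sum]
  exact Finset.sum_congr rfl fun j _ => by rw [← hadj, mul_assoc]

/-- Differentiate G G⁻¹ = 1, an identity valid on a whole neighbourhood since the determinant stays
non-zero near `x`. -/
lemma pd_inv (hG : ∀ i j, ContDiffAt ℝ ∞ (fun y => G y i j) x) (h0 : (G x).det ≠ 0) (v : X)
    (i j : ι) : pd v (fun y => (G y)⁻¹ i j) x
      = - ∑ k, ∑ l, (G x)⁻¹ i k * pd v (fun y => G y k l) x * (G x)⁻¹ l j := by
  have hI := contDiffAt_inv hG h0
  have hev : ∀ᶠ y in nhds x, (G y).det ≠ 0 := (contDiffAt_det hG).continuousAt.eventually_ne h0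
  let dG : Matrix ι ι ℝ := Matrix.of fun k l => pd v (fun y => G y k l) x
  let dI : Matrix ι ι ℝ := Matrix.of fun k l => pd v (fun y => (G y)⁻¹ k l) x
  have h1 : dG * (G x)⁻¹ + G x * dI = 0 := by
    ext k l
    have h2 : (fun y => ∑ m, G y k m * (G y)⁻¹ m l) =ᶠ[nhds x] fun _ => (1 : Matrix ι ι ℝ) k l := by
      filter_upwards [hev] with y hy
      rw [← Matrix.mul_apply, Matrix.mul_nonsing_inv _ (isUnit_iff_ne_zero.2 hy)]
    have h3 := pd_congr (v := v) h2
    rw [pd_const, pd_sum fun m _ => (hG k m).diff.fun_mul (hI m l).diff] at h3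
    rw [Finset.sum_congr rfl fun m _ => pd_mul (hG k m).diff (hI m l).diff,
      Finset.sum_add_distrib] at h3
    simpa [Matrix.mul_apply, dG, dI] using h3
  have h4 : dI = - ((G x)⁻¹ * dG * (G x)⁻¹) := by
    have hu := Matrix.nonsing_inv_mul _ (isUnit_iff_ne_zero.2 h0)
    calc dI = (G x)⁻¹ * (G x * dI) := by rw [← mul_assoc, hu, one_mul]
      _ = (G x)⁻¹ * (- (dG * (G x)⁻¹)) := by rw [eq_neg_of_add_eq_zero_right h1]
      _ = _ := by rw [mul_neg, mul_assoc]
  have h5 := congrFun (congrFun h4 i) j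
  simp only [dI, Matrix.of_apply, Matrix.neg_apply] at h5
  rw [h5, Matrix.mul_apply]
  simp only [Matrix.mul_apply, dG, Matrix.of_apply, Finset.sum_mul]
  rw [Finset.sum_comm]

end MatrixCalculus

lemma inv_symm {ι : Type*} [Fintype ι] [DecidableEq ι] {A : Matrix ι ι ℝ}
    (hs : ∀ i j, A i j = A j i) (i j : ι) : A⁻¹ i j = A⁻¹ j i := by
  have h : A.transpose = A := by ext i j; exact hs j i
  conv_lhs => rw [← h, ← Matrix.transpose_nonsing_inv]
  rfl

/-! ### Christoffel symbols and metric compatibility. -/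

section Christoffel

variable {X : Type*} [NormedAddCommGroup X] [NormedSpace ℝ X] {ι : Type*} [Fintype ι]
  [DecidableEq ι] {b : ι → X} {G : X → Matrix ι ι ℝ} {x : X}

lemma christoffel_symm (hs : ∀ y i j, G y i j = G y j i) (k i j : ι) :
    christoffel b G k i j x = christoffel b G k j i x := by
  unfold christoffel
  congr 1
  refine Finset.sum_congr rfl fun m _ => ?_
  rw [funext fun y => hs y m j, funext fun y => hs y i m, funext fun y => hs y i j]
  ring

lemma contDiffAt_christoffel (hG : ∀ i j, ContDiffAt ℝ ∞ (fun y => G y i j) x)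
    (h0 : (G x).det ≠ 0) (k i j : ι) : ContDiffAt ℝ ∞ (christoffel b G k i j) x := by
  unfold christoffel
  exact contDiffAt_const.mul (ContDiffAt.sum fun m _ => (contDiffAt_inv hG h0 k m).mul
    (((hG m j).pd.add (hG i m).pd).sub (hG i j).pd))

/-- Multiplying by G undoes the inverse in the definition and leaves the Christoffel symbols of the
first kind. -/
lemma sum_mul_christoffel (h0 : (G x).det ≠ 0) (l i j : ι) :
    ∑ k, G x l k * christoffel b G k i j x
      = (1 / 2) * (pd (b i) (fun y => G y l j) x + pd (b j) (fun y => G y i l) x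
      - pd (b l) (fun y => G y i j) x) := by
  set r : ι → ℝ := fun m => (1 / 2) * (pd (b i) (fun y => G y m j) x +
    pd (b j) (fun y => G y i m) x - pd (b m) (fun y => G y i j) x) with hr
  have h1 : (fun k => christoffel b G k i j x) = (G x)⁻¹.mulVec r := by
    ext k
    simp only [christoffel, Matrix.mulVec, dotProduct, hr, Finset.mul_sum]
    exact Finset.sum_congr rfl fun m _ => by ring
  have h2 : (G x).mulVec (fun k => christoffel b G k i j x) l = r l := by
    rw [h1, Matrix.mulVec_mulVec, Matrix.mul_nonsing_inv _ (isUnit_iff_ne_zero.2 h0),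
      Matrix.one_mulVec]
  exact h2

/-- Metric compatibility of the Christoffel symbols. -/
lemma pd_metric (hs : ∀ y i j, G y i j = G y j i) (h0 : (G x).det ≠ 0) (m k l : ι) :
    pd (b m) (fun y => G y k l) x
      = ∑ s, (christoffel b G s m k x * G x s l + G x k s * christoffel b G s m l x) := by
  rw [Finset.sum_add_distrib, sum_mul_christoffel h0 k m l]
  have : ∑ s, christoffel b G s m k x * G x s l = ∑ s, G x l s * christoffel b G s m k x :=
    Finset.sum_congr rfl fun s _ => by rw [hs x s l, mul_comm]
  rw [this, sum_mul_christoffel h0 l m k, funext fun y => hs y l k, funext fun y => hs y m l]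
  ring

lemma pd_metric_matrix (hs : ∀ y i j, G y i j = G y j i) (h0 : (G x).det ≠ 0) (m : ι) :
    (Matrix.of fun k l => pd (b m) (fun y => G y k l) x)
      = (Matrix.of fun s k => christoffel b G s m k x).transpose * G x
        + G x * (Matrix.of fun s k => christoffel b G s m k x) := by
  ext k l
  simp only [Matrix.of_apply, Matrix.add_apply, Matrix.mul_apply, Matrix.transpose_apply]
  rw [pd_metric hs h0, Finset.sum_add_distrib]

/-- This is ∇G⁻¹ = 0: the compatibility identity for ∂G is multiplied on both sides by G⁻¹. -/
lemma pd_inv_metric (hs : ∀ y i j, G y i j = G y j i)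
    (hG : ∀ i j, ContDiffAt ℝ ∞ (fun y => G y i j) x) (h0 : (G x).det ≠ 0) (m i j : ι) :
    pd (b m) (fun y => (G y)⁻¹ i j) x
      = - ∑ k, ((G x)⁻¹ i k * christoffel b G j m k x
        + christoffel b G i m k x * (G x)⁻¹ k j) := by
  set Γ : Matrix ι ι ℝ := Matrix.of fun s k => christoffel b G s m k x with hΓ
  set dG : Matrix ι ι ℝ := Matrix.of fun k l => pd (b m) (fun y => G y k l) x with hdG
  have hu := Matrix.nonsing_inv_mul _ (isUnit_iff_ne_zero.2 h0)
  have hu' := Matrix.mul_nonsing_inv _ (isUnit_iff_ne_zero.2 h0)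
  have h1 : (G x)⁻¹ * dG * (G x)⁻¹ = (G x)⁻¹ * Γ.transpose + Γ * (G x)⁻¹ := by
    rw [hdG, pd_metric_matrix hs h0]
    calc (G x)⁻¹ * (Γ.transpose * G x + G x * Γ) * (G x)⁻¹
        = (G x)⁻¹ * Γ.transpose * (G x * (G x)⁻¹) + (G x)⁻¹ * G x * Γ * (G x)⁻¹ := by noncomm_ring
      _ = _ := by rw [hu, hu', mul_one, one_mul]
  have h2 := congrFun (congrFun h1 i) j
  rw [pd_inv hG h0, Finset.sum_add_distrib, neg_inj]
  simp only [Matrix.add_apply, Matrix.mul_apply, Matrix.transpose_apply, hΓ, hdG,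
    Matrix.of_apply, Finset.sum_mul] at h2
  rw [← h2, Finset.sum_comm]

/-- The contracted Christoffel symbols `g^{μν} Γ^i_{μν}`. -/
def contracted (b : ι → X) (G : X → Matrix ι ι ℝ) (i : ι) (x : X) : ℝ :=
  ∑ μ, ∑ ν, (G x)⁻¹ μ ν * christoffel b G i μ ν x

lemma contDiffAt_contracted (hG : ∀ i j, ContDiffAt ℝ ∞ (fun y => G y i j) x)
    (h0 : (G x).det ≠ 0) (i : ι) : ContDiffAt ℝ ∞ (contracted b G i) x := by
  unfold contracted
  exact ContDiffAt.sum fun μ _ => ContDiffAt.sum fun ν _ => (contDiffAt_inv hG h0 μ ν).mul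
    (contDiffAt_christoffel hG h0 _ _ _)

/-- By Jacobi's formula the logarithmic derivative is half the trace of G⁻¹ ∂G. The two summands of
∂G in `pd_metric_matrix` each contribute the trace of Γ, which cancels the half. -/
lemma pd_sqrt_det (hs : ∀ y i j, G y i j = G y j i)
    (hG : ∀ i j, ContDiffAt ℝ ∞ (fun y => G y i j) x) (h0 : (G x).det ≠ 0) (m : ι) :
    pd (b m) (fun y => Real.sqrt |(G y).det|) x
      = Real.sqrt |(G x).det| * ∑ k, christoffel b G k m k x := by
  set Γ : Matrix ι ι ℝ := Matrix.of fun s k => christoffel b G s m k x with hΓ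
  have hu := Matrix.nonsing_inv_mul _ (isUnit_iff_ne_zero.2 h0)
  have hu' := Matrix.mul_nonsing_inv _ (isUnit_iff_ne_zero.2 h0)
  have h1 : ∑ i, ∑ j, (G x)⁻¹ i j * pd (b m) (fun y => G y j i) x = 2 * Γ.trace := by
    have : ∑ i, ∑ j, (G x)⁻¹ i j * pd (b m) (fun y => G y j i) x
        = ((G x)⁻¹ * Matrix.of fun k l => pd (b m) (fun y => G y k l) x).trace := by
      simp only [Matrix.trace, Matrix.diag, Matrix.mul_apply, Matrix.of_apply]
    rw [this, pd_metric_matrix hs h0, mul_add, Matrix.trace_add, ← mul_assoc, ← mul_assoc,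
      Matrix.trace_mul_comm, ← mul_assoc, hu, hu', one_mul, one_mul, Matrix.trace_transpose,
      two_mul]
  rw [pd_sqrt_abs (contDiffAt_det hG).diff h0, pd_det (fun i j => (hG i j).diff) h0, h1,
    mul_div_cancel_left₀ _ h0]
  simp [Matrix.trace, hΓ]

/-- `∂_i (√|G| G^{ij}) = - √|G| G^{μν} Γ^j_{μν}`. -/
lemma sum_pd_sqrt_det_mul_inv (hs : ∀ y i j, G y i j = G y j i)
    (hG : ∀ i j, ContDiffAt ℝ ∞ (fun y => G y i j) x) (h0 : (G x).det ≠ 0) (j : ι) :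
    ∑ i, pd (b i) (fun y => Real.sqrt |(G y).det| * (G y)⁻¹ i j) x
      = - (Real.sqrt |(G x).det| * contracted b G j x) := by
  have h1 : ∀ i, pd (b i) (fun y => Real.sqrt |(G y).det| * (G y)⁻¹ i j) x
      = Real.sqrt |(G x).det| * (∑ k, christoffel b G k i k x * (G x)⁻¹ i j
        - ∑ k, (G x)⁻¹ i k * christoffel b G j i k x
        - ∑ k, christoffel b G i k i x * (G x)⁻¹ k j) := by
    intro i
    rw [pd_mul (contDiffAt_sqrt_abs (contDiffAt_det hG) h0).diff (contDiffAt_inv hG h0 i j).diff,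
      pd_sqrt_det hs hG h0, pd_inv_metric hs hG h0, Finset.sum_add_distrib, ← Finset.sum_mul]
    simp only [christoffel_symm hs i i]
    ring
  rw [Finset.sum_congr rfl fun i _ => h1 i, ← Finset.mul_sum, Finset.sum_sub_distrib,
    Finset.sum_sub_distrib]
  -- After exchanging indices, the trace of Γ from the density cancels the second half of ∂G⁻¹; only
  -- the contracted symbols survive.
  rw [Finset.sum_comm (f := fun i k => christoffel b G i k i x * (G x)⁻¹ k j)]
  simp only [contracted]
  ring

end Christoffel

/-! ### Smoothness of vector fields along maps. -/

section TangentMap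

variable {E : Type*} [NormedAddCommGroup E] [NormedSpace ℝ E] {H : Type*} [TopologicalSpace H]
  {I : ModelWithCorners ℝ E H} {M : Type*} [TopologicalSpace M] [ChartedSpace H M]
  [IsManifold I ∞ M]
  {E' : Type*} [NormedAddCommGroup E'] [NormedSpace ℝ E'] {H' : Type*} [TopologicalSpace H']
  {I' : ModelWithCorners ℝ E' H'} {M' : Type*} [TopologicalSpace M'] [ChartedSpace H' M']
  [IsManifold I' ∞ M']
  {E₀ : Type*} [NormedAddCommGroup E₀] [NormedSpace ℝ E₀] {H₀ : Type*} [TopologicalSpace H₀]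
  {I₀ : ModelWithCorners ℝ E₀ H₀} {B : Type*} [TopologicalSpace B] [ChartedSpace H₀ B]

/-- The derivative of a smooth map sends smooth sections along `s` to smooth sections. -/
lemma contMDiffAt_mfderiv_section {f : M → M'} {s : B → M} {v : ∀ b, TangentSpace I (s b)} {x : B}
    (hf : ContMDiffAt I I' ∞ f (s x))
    (hv : ContMDiffAt I₀ I.tangent ∞ (fun b => (⟨s b, v b⟩ : TangentBundle I M)) x) :
    ContMDiffAt I₀ I'.tangent ∞
      (fun b => (⟨f (s b), mfderiv I I' f (s b) (v b)⟩ : TangentBundle I' M')) x := by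
  have : IsManifold I 1 M := IsManifold.of_le (n := ∞) (by simp)
  have : IsManifold I' 1 M' := IsManifold.of_le (n := ∞) (by simp)
  have hs : ContMDiffAt I₀ I ∞ s x := by
    rw [Bundle.contMDiffAt_totalSpace] at hv; exact hv.1
  have hϕ := (hf.mfderiv_const (m := ∞) (by simp)).comp x hs
  exact ContMDiffAt.clm_apply_of_inCoordinates hϕ hv (hf.comp x hs)

lemma contDiffAt_of_section {s : B → E} {v : ∀ b, TangentSpace 𝓘(ℝ, E) (s b)} {x : B}
    (hv : ContMDiffAt I₀ 𝓘(ℝ, E).tangent ∞ (fun b => (⟨s b, v b⟩ : TangentBundle 𝓘(ℝ, E) E)) x) :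
    ContMDiffAt I₀ 𝓘(ℝ, E) ∞ (fun b => (show E from v b)) x :=
  (contMDiff_snd_tangentBundle_modelSpace E 𝓘(ℝ, E)).contMDiffAt.comp x hv

lemma contMDiffAt_const_section (v : E) (x : E) :
    ContMDiffAt 𝓘(ℝ, E) 𝓘(ℝ, E).tangent ∞ (fun b => (⟨b, v⟩ : TangentBundle 𝓘(ℝ, E) E)) x := by
  rw [Bundle.contMDiffAt_totalSpace]
  refine ⟨contMDiffAt_id, ?_⟩
  simpa using contMDiffAt_const

end TangentMap

/-! ### Metric coefficients in a chart. -/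

section Charts

variable {d : ℕ} {M : Type*} [TopologicalSpace M] [ChartedSpace (EuclideanSpace ℝ (Fin d)) M]
  [IsManifold (𝓡 d) ∞ M] {φ : OpenPartialHomeomorph M (EuclideanSpace ℝ (Fin d))}

lemma mdifferentiable_chart (hφ : φ ∈ IsManifold.maximalAtlas (𝓡 d) ∞ M) :
    φ.MDifferentiable (𝓡 d) (𝓡 d) :=
  ⟨(contMDiffOn_of_mem_maximalAtlas hφ).mdifferentiableOn (by simp),
    (contMDiffOn_symm_of_mem_maximalAtlas hφ).mdifferentiableOn (by simp)⟩

lemma mfderiv_symm_mfderiv (hφ : φ ∈ IsManifold.maximalAtlas (𝓡 d) ∞ M) {x : M}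
    (hx : x ∈ φ.source) (v : TangentSpace (𝓡 d) x) :
    mfderiv (𝓡 d) (𝓡 d) φ.symm (φ x) (mfderiv (𝓡 d) (𝓡 d) φ x v) = v :=
  congrArg (fun L => L v) ((mdifferentiable_chart hφ).symm_comp_deriv hx)

lemma mfderiv_mfderiv_symm (hφ : φ ∈ IsManifold.maximalAtlas (𝓡 d) ∞ M)
    {y : EuclideanSpace ℝ (Fin d)} (hy : y ∈ φ.target) (v : TangentSpace (𝓡 d) y) :
    mfderiv (𝓡 d) (𝓡 d) φ (φ.symm y) (mfderiv (𝓡 d) (𝓡 d) φ.symm y v) = v :=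
  congrArg (fun L => L v) ((mdifferentiable_chart hφ).comp_symm_deriv hy)

lemma metricCoeff_symm (g : RiemMetric d M) (y : EuclideanSpace ℝ (Fin d)) (i j : Fin d) :
    metricCoeff g φ y i j = metricCoeff g φ y j i :=
  g.symm _ _ _

lemma inner_mfderiv_symm (g : RiemMetric d M) (y v w : EuclideanSpace ℝ (Fin d)) :
    g.inner (φ.symm y) (mfderiv (𝓡 d) (𝓡 d) φ.symm y v) (mfderiv (𝓡 d) (𝓡 d) φ.symm y w)
      = ∑ k, ∑ l, metricCoeff g φ y k l * v k * w l := by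
  set L : EuclideanSpace ℝ (Fin d) →L[ℝ] TangentSpace (𝓡 d) (φ.symm y) :=
    mfderiv (𝓡 d) (𝓡 d) φ.symm y with hL
  have hsum : ∀ v : EuclideanSpace ℝ (Fin d),
      L v = ∑ k, v k • L (EuclideanSpace.single k (1 : ℝ)) := by
    intro v
    conv_lhs => rw [← (EuclideanSpace.basisFun (Fin d) ℝ).sum_repr v]
    simp
  change g.inner (φ.symm y) (L v) (L w) = _
  rw [hsum v, hsum w]
  simp only [map_sum, map_smul, FunLike.coe_sum, Finset.sum_apply, FunLike.coe_smul, Pi.smul_apply,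
    smul_eq_mul, Finset.mul_sum]
  rw [Finset.sum_comm]
  refine Finset.sum_congr rfl fun k _ => Finset.sum_congr rfl fun l _ => ?_
  change _ = g.inner (φ.symm y) (L _) (L _) * _ * _
  ring

lemma inner_eq_sum (g : RiemMetric d M) (hφ : φ ∈ IsManifold.maximalAtlas (𝓡 d) ∞ M) {x : M}
    (hx : x ∈ φ.source) (v w : TangentSpace (𝓡 d) x) :
    g.inner x v w = ∑ k, ∑ l, metricCoeff g φ (φ x) k l *
      (show EuclideanSpace ℝ (Fin d) from mfderiv (𝓡 d) (𝓡 d) φ x v) k *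
      (show EuclideanSpace ℝ (Fin d) from mfderiv (𝓡 d) (𝓡 d) φ x w) l := by
  rw [← inner_mfderiv_symm]
  -- The points `x` and `φ.symm (φ x)` are equal but not definitionally, so the base point is
  -- generalised before the tangent vectors are compared.
  have key : ∀ (x' : M) (_ : x' = x) (v' w' : EuclideanSpace ℝ (Fin d)),
      v' = v → w' = w → g.inner x v w = g.inner x' v' w' := by
    rintro x' rfl v' w' rfl rfl; rfl
  exact key _ (φ.left_inv hx) _ _ (mfderiv_symm_mfderiv hφ hx v) (mfderiv_symm_mfderiv hφ hx w)

/-- A kernel vector of the coefficient matrix would map to a tangent vector of length zero, hence to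
zero by positivity; the derivative of the inverse chart is injective. -/
lemma det_metricCoeff_ne_zero (g : RiemMetric d M)
    (hφ : φ ∈ IsManifold.maximalAtlas (𝓡 d) ∞ M) {y : EuclideanSpace ℝ (Fin d)}
    (hy : y ∈ φ.target) : (metricCoeff g φ y).det ≠ 0 := by
  intro h0
  obtain ⟨v, hv, hv0⟩ := Matrix.exists_mulVec_eq_zero_iff.2 h0
  set v' : EuclideanSpace ℝ (Fin d) := WithLp.toLp 2 v with hv'
  have h1 : g.inner (φ.symm y) (mfderiv (𝓡 d) (𝓡 d) φ.symm y v')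
      (mfderiv (𝓡 d) (𝓡 d) φ.symm y v') = 0 := by
    rw [inner_mfderiv_symm]
    have : ∀ k, ∑ l, metricCoeff g φ y k l * v' k * v' l = 0 := by
      intro k
      have h2 : ∑ l, metricCoeff g φ y k l * v l = 0 := congrFun hv0 k
      calc ∑ l, metricCoeff g φ y k l * v' k * v' l
          = v k * ∑ l, metricCoeff g φ y k l * v l := by
            rw [Finset.mul_sum]; exact Finset.sum_congr rfl fun l _ => by simp [hv']; ring
        _ = 0 := by rw [h2, mul_zero]
    exact Finset.sum_eq_zero fun k _ => this k
  have h2 : mfderiv (𝓡 d) (𝓡 d) φ.symm y v' = 0 := by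
    by_contra hne
    exact (g.pos _ _ hne).ne' h1
  have h3 := mfderiv_mfderiv_symm hφ hy v'
  rw [h2, map_zero] at h3
  apply hv
  have h4 : v' = 0 := h3.symm
  ext k
  simpa [hv'] using congrArg (fun z : EuclideanSpace ℝ (Fin d) => z k) h4

lemma contDiffAt_metricCoeff (g : RiemMetric d M)
    (hφ : φ ∈ IsManifold.maximalAtlas (𝓡 d) ∞ M) {y : EuclideanSpace ℝ (Fin d)}
    (hy : y ∈ φ.target) (i j : Fin d) :
    ContDiffAt ℝ ∞ (fun y => metricCoeff g φ y i j) y := by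
  have hs := contMDiffAt_symm_of_mem_maximalAtlas hφ hy
  have hv : ∀ v : EuclideanSpace ℝ (Fin d), ContMDiffAt (𝓡 d) (𝓡 d).tangent ∞
      (fun b => (⟨φ.symm b, mfderiv (𝓡 d) (𝓡 d) φ.symm b v⟩ : TangentBundle (𝓡 d) M)) y :=
    fun v => contMDiffAt_mfderiv_section hs (contMDiffAt_const_section v y)
  have key : ContMDiffAt (𝓡 d) ((𝓡 d).prod 𝓘(ℝ)) ∞ (fun y =>
      Bundle.TotalSpace.mk' ℝ (E := Bundle.Trivial M ℝ) (φ.symm y) (metricCoeff g φ y i j)) y := by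
    apply ContMDiffAt.clm_bundle_apply₂ (F₁ := EuclideanSpace ℝ (Fin d))
      (F₂ := EuclideanSpace ℝ (Fin d))
    · exact g.contMDiff.contMDiffAt.comp y hs
    · exact hv _
    · exact hv _
  rw [Bundle.contMDiffAt_totalSpace] at key
  exact contMDiffAt_iff_contDiffAt.1 key.2

end Charts

/-! ### The map and the frame in coordinates. -/

section Pullback

variable {d n : ℕ} {M : Type*} [TopologicalSpace M]
  [ChartedSpace (EuclideanSpace ℝ (Fin d)) M] [IsManifold (𝓡 d) ∞ M]
  {N : Type*} [TopologicalSpace N] [ChartedSpace (EuclideanSpace ℝ (Fin n)) N]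
  [IsManifold (𝓡 n) ∞ N]
  {h : RiemMetric n N} {u : ℝ × M → N} {e : Fin n → (z : ℝ × M) → TangentSpace (𝓡 n) (u z)}
  {φ : OpenPartialHomeomorph M (EuclideanSpace ℝ (Fin d))}
  {ψ : OpenPartialHomeomorph N (EuclideanSpace ℝ (Fin n))}
  {p : ℝ × EuclideanSpace ℝ (Fin d)}

lemma contMDiffAt_coord_symm (hφ : φ ∈ IsManifold.maximalAtlas (𝓡 d) ∞ M) (hp : p.2 ∈ φ.target) :
    ContMDiffAt 𝓘(ℝ, ℝ × EuclideanSpace ℝ (Fin d)) (𝓘(ℝ, ℝ).prod (𝓡 d)) ∞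
      (fun p : ℝ × EuclideanSpace ℝ (Fin d) => (p.1, φ.symm p.2)) p := by
  have h1 : ContMDiffAt 𝓘(ℝ, ℝ × EuclideanSpace ℝ (Fin d)) 𝓘(ℝ, ℝ) ∞
      (fun p : ℝ × EuclideanSpace ℝ (Fin d) => p.1) p := contDiffAt_fst.contMDiffAt
  have h2 : ContMDiffAt 𝓘(ℝ, ℝ × EuclideanSpace ℝ (Fin d)) (𝓡 d) ∞
      (fun p : ℝ × EuclideanSpace ℝ (Fin d) => p.2) p := contDiffAt_snd.contMDiffAt
  exact h1.prodMk ((contMDiffAt_symm_of_mem_maximalAtlas hφ hp).comp p h2)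

lemma contMDiffAt_pull (hu : ContMDiff (𝓘(ℝ, ℝ).prod (𝓡 d)) (𝓡 n) ∞ u)
    (hφ : φ ∈ IsManifold.maximalAtlas (𝓡 d) ∞ M) (hp : p.2 ∈ φ.target) :
    ContMDiffAt 𝓘(ℝ, ℝ × EuclideanSpace ℝ (Fin d)) (𝓡 n) ∞ (pull u φ) p :=
  hu.contMDiffAt.comp p (contMDiffAt_coord_symm hφ hp)

lemma coordDomain_mem_nhds (hu : ContMDiff (𝓘(ℝ, ℝ).prod (𝓡 d)) (𝓡 n) ∞ u)
    (hφ : φ ∈ IsManifold.maximalAtlas (𝓡 d) ∞ M) (hp : p ∈ coordDomain u φ ψ) :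
    ∀ᶠ p' in nhds p, p' ∈ coordDomain u φ ψ :=
  (continuousAt_snd.eventually_mem (φ.open_target.mem_nhds hp.1)).and
    ((contMDiffAt_pull hu hφ hp.1).continuousAt.eventually_mem (ψ.open_source.mem_nhds hp.2))

lemma contDiffAt_chart_pull (hu : ContMDiff (𝓘(ℝ, ℝ).prod (𝓡 d)) (𝓡 n) ∞ u)
    (hφ : φ ∈ IsManifold.maximalAtlas (𝓡 d) ∞ M) (hψ : ψ ∈ IsManifold.maximalAtlas (𝓡 n) ∞ N)
    (hp : p ∈ coordDomain u φ ψ) : ContDiffAt ℝ ∞ (fun p => ψ (pull u φ p)) p :=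
  contMDiffAt_iff_contDiffAt.1
    ((contMDiffAt_of_mem_maximalAtlas hψ hp.2).comp p (contMDiffAt_pull hu hφ hp.1))

lemma contDiffAt_frameCoord (he : IsOrthonormalFrame (d := d) h u e)
    (hφ : φ ∈ IsManifold.maximalAtlas (𝓡 d) ∞ M) (hψ : ψ ∈ IsManifold.maximalAtlas (𝓡 n) ∞ N)
    (hp : p ∈ coordDomain u φ ψ) (a k : Fin n) :
    ContDiffAt ℝ ∞ (fun p => frameCoord u e φ ψ a p k) p := by
  have h1 : ContMDiffAt 𝓘(ℝ, ℝ × EuclideanSpace ℝ (Fin d)) (𝓡 n).tangent ∞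
      (fun p : ℝ × EuclideanSpace ℝ (Fin d) =>
        (⟨pull u φ p, e a (p.1, φ.symm p.2)⟩ : TangentBundle (𝓡 n) N)) p :=
    (he.smooth a).contMDiffAt.comp p (contMDiffAt_coord_symm hφ hp.1)
  have h2 := contMDiffAt_mfderiv_section (contMDiffAt_of_mem_maximalAtlas hψ hp.2) h1
  have h3 := contMDiffAt_iff_contDiffAt.1 (contDiffAt_of_section h2)
  exact (contDiffAt_euclidean.1 h3) k

lemma pair_frameCoord (he : IsOrthonormalFrame (d := d) h u e)
    (hψ : ψ ∈ IsManifold.maximalAtlas (𝓡 n) ∞ N) (hp : p ∈ coordDomain u φ ψ) (a b : Fin n) :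
    pair h u φ ψ p (frameCoord u e φ ψ a p) (frameCoord u e φ ψ b p) = if a = b then 1 else 0 := by
  rw [← he.orthonormal a b (p.1, φ.symm p.2)]
  exact (inner_eq_sum h hψ hp.2 _ _).symm

/-- The intrinsic `q` does not involve `ψ`; the chain rule for `ψ ∘ pull u φ` brings it into the
coordinates in which the connection is defined. -/
lemma q_eq_pair (hu : ContMDiff (𝓘(ℝ, ℝ).prod (𝓡 d)) (𝓡 n) ∞ u)
    (hφ : φ ∈ IsManifold.maximalAtlas (𝓡 d) ∞ M) (hψ : ψ ∈ IsManifold.maximalAtlas (𝓡 n) ∞ N)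
    (hp : p ∈ coordDomain u φ ψ) (a : Fin n) (α : Fin (d + 1)) :
    q h u e φ a α p = pair h u φ ψ p (du u φ ψ α p) (frameCoord u e φ ψ a p) := by
  have hd : ∀ k, du u φ ψ α p k = (show EuclideanSpace ℝ (Fin n) from
      mfderiv (𝓡 n) (𝓡 n) ψ (pull u φ p)
        (mfderiv 𝓘(ℝ, ℝ × EuclideanSpace ℝ (Fin d)) (𝓡 n) (pull u φ) p (dir d α))) k := by
    intro k
    have hw := (contDiffAt_chart_pull hu hφ hψ hp).diff
    have h1 : fderiv ℝ (fun p => ψ (pull u φ p)) p (dir d α) =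
        mfderiv (𝓡 n) (𝓡 n) ψ (pull u φ p)
        (mfderiv 𝓘(ℝ, ℝ × EuclideanSpace ℝ (Fin d)) (𝓡 n) (pull u φ) p (dir d α)) := by
      rw [← mfderiv_eq_fderiv]
      exact congrArg (fun L => L (dir d α)) (mfderiv_comp p
        ((contMDiffAt_of_mem_maximalAtlas hψ hp.2).mdifferentiableAt (by simp))
        ((contMDiffAt_pull hu hφ hp.1).mdifferentiableAt (by simp)))
    rw [← h1]
    exact pd_apply_euclidean hw (dir d α) k
  refine (inner_eq_sum h hψ hp.2 _ _).trans ?_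
  unfold pair
  exact Finset.sum_congr rfl fun k _ => Finset.sum_congr rfl fun l _ => by rw [hd k]; rfl

end Pullback

/-! ### Expansion in an orthonormal frame. -/

section Parseval

variable {κ : Type*} [Fintype κ] [DecidableEq κ]

/-- Parseval's identity for a frame which is orthonormal for the symmetric form `H`. -/
lemma parseval_of_orthonormal {H E : Matrix κ κ ℝ} (hH : ∀ k l, H k l = H l k)
    (hE : E * H * E.transpose = 1) (V W : κ → ℝ) :
    ∑ k, ∑ l, H k l * V k * W l
      = ∑ c, (∑ k, ∑ l, H k l * V k * E c l) * (∑ k, ∑ l, H k l * W k * E c l) := by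
  have hT : H.transpose = H := by ext i j; exact hH j i
  have hform : ∀ V W : κ → ℝ, ∑ k, ∑ l, H k l * V k * W l = V ⬝ᵥ H.mulVec W := by
    intro V W
    simp only [dotProduct, Matrix.mulVec, Finset.mul_sum]
    exact Finset.sum_congr rfl fun k _ => Finset.sum_congr rfl fun l _ => by ring
  -- Orthonormality says that E is a left inverse of H Eᵀ; for square matrices it is also a right
  -- inverse, which is completeness of the frame.
  have h1 : H * E.transpose * E = 1 := by
    rw [mul_assoc] at hE
    exact mul_eq_one_comm.1 hE
  have hcoef : ∀ V c, ∑ k, ∑ l, H k l * V k * E c l = E.mulVec (H.mulVec V) c := by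
    intro V c
    rw [hform, dotProduct_comm, ← Matrix.vecMul_transpose, hT, ← Matrix.dotProduct_mulVec]
    rw [Matrix.mulVec]
  simp only [hcoef]
  rw [hform]
  change _ = E.mulVec (H.mulVec V) ⬝ᵥ E.mulVec (H.mulVec W)
  rw [Matrix.dotProduct_mulVec, Matrix.dotProduct_mulVec, ← Matrix.mulVec_transpose E,
    Matrix.mulVec_mulVec, Matrix.mulVec_mulVec, ← Matrix.mulVec_transpose H, hT]
  have h2 : E.transpose * E * H = 1 := by
    have := congrArg Matrix.transpose h1
    simpa [Matrix.transpose_mul, hT, mul_assoc] using this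
  rw [Matrix.dotProduct_mulVec, ← Matrix.mulVec_transpose H, hT, Matrix.mulVec_mulVec,
    ← mul_assoc, mul_assoc H, h2, mul_one]

end Parseval

/-! ### The pull-back connection: compatibility and torsion. -/

section PullbackConnection

variable {X : Type*} [NormedAddCommGroup X] [NormedSpace ℝ X]

lemma pd_comp {n : ℕ} {w : X → EuclideanSpace ℝ (Fin n)} {f : EuclideanSpace ℝ (Fin n) → ℝ} {x : X}
    (hw : DifferentiableAt ℝ w x) (hf : DifferentiableAt ℝ f (w x)) (v : X) :
    pd v (fun y => f (w y)) x
      = ∑ m, pd (EuclideanSpace.single m (1 : ℝ)) f (w x) * pd v (fun y => w y m) x := by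
  have h := (hf.hasFDerivAt.comp x hw.hasFDerivAt).fderiv
  have h1 : pd v (fun y => f (w y)) x = fderiv ℝ f (w x) (fderiv ℝ w x v) :=
    congrArg (fun L => L v) h
  have h2 : fderiv ℝ w x v = ∑ m, (fderiv ℝ w x v) m • EuclideanSpace.single m (1 : ℝ) := by
    conv_lhs => rw [← (EuclideanSpace.basisFun (Fin n) ℝ).sum_repr (fderiv ℝ w x v)]
    simp
  rw [h1, h2, map_sum]
  refine Finset.sum_congr rfl fun m _ => ?_
  rw [map_smul, pd_apply_euclidean hw, smul_eq_mul, mul_comm]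
  rfl

variable {d n : ℕ} {M : Type*} [TopologicalSpace M]
  [ChartedSpace (EuclideanSpace ℝ (Fin d)) M] [IsManifold (𝓡 d) ∞ M]
  {N : Type*} [TopologicalSpace N] [ChartedSpace (EuclideanSpace ℝ (Fin n)) N]
  [IsManifold (𝓡 n) ∞ N]
  {h : RiemMetric n N} {u : ℝ × M → N}
  {φ : OpenPartialHomeomorph M (EuclideanSpace ℝ (Fin d))}
  {ψ : OpenPartialHomeomorph N (EuclideanSpace ℝ (Fin n))}
  {p : ℝ × EuclideanSpace ℝ (Fin d)}

/-- The connection matrix `Ω^k_j = Γ^k_{ij}(u) ∂_α u^i` of the pull-back connection in the chart. -/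
def connMatrix (h : RiemMetric n N) (u : ℝ × M → N)
    (φ : OpenPartialHomeomorph M (EuclideanSpace ℝ (Fin d)))
    (ψ : OpenPartialHomeomorph N (EuclideanSpace ℝ (Fin n))) (α : Fin (d + 1))
    (p : ℝ × EuclideanSpace ℝ (Fin d)) (k j : Fin n) : ℝ :=
  ∑ i, christoffel (fun i : Fin n => EuclideanSpace.single i (1 : ℝ)) (metricCoeff h ψ)
      k i j (ψ (pull u φ p)) * du u φ ψ α p i

lemma covD_eq (α : Fin (d + 1)) (V : ℝ × EuclideanSpace ℝ (Fin d) → Fin n → ℝ) (k : Fin n) :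
    covD h u φ ψ α V p k
      = pd (dir d α) (fun p' => V p' k) p + ∑ j, connMatrix h u φ ψ α p k j * V p j := by
  unfold covD connMatrix
  rw [Finset.sum_comm]
  simp only [Finset.sum_mul]

lemma pair_comm (V W : Fin n → ℝ) : pair h u φ ψ p V W = pair h u φ ψ p W V := by
  unfold pair
  rw [Finset.sum_comm]
  exact Finset.sum_congr rfl fun k _ => Finset.sum_congr rfl fun l _ => by
    rw [metricCoeff_symm]; ring

lemma pair_add_left (V V' W : Fin n → ℝ) :
    pair h u φ ψ p (fun k => V k + V' k) W = pair h u φ ψ p V W + pair h u φ ψ p V' W := by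
  unfold pair
  simp only [← Finset.sum_add_distrib]
  exact Finset.sum_congr rfl fun k _ => Finset.sum_congr rfl fun l _ => by ring

lemma pair_smul_left (a : ℝ) (V W : Fin n → ℝ) :
    pair h u φ ψ p (fun k => a * V k) W = a * pair h u φ ψ p V W := by
  unfold pair
  simp only [Finset.mul_sum]
  exact Finset.sum_congr rfl fun k _ => Finset.sum_congr rfl fun l _ => by ring

lemma pair_sub_left (V V' W : Fin n → ℝ) :
    pair h u φ ψ p (fun k => V k - V' k) W = pair h u φ ψ p V W - pair h u φ ψ p V' W := by
  unfold pair
  simp only [← Finset.sum_sub_distrib]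
  exact Finset.sum_congr rfl fun k _ => Finset.sum_congr rfl fun l _ => by ring

lemma pair_sum_left {ι : Type*} (s : Finset ι) (V : ι → Fin n → ℝ) (W : Fin n → ℝ) :
    pair h u φ ψ p (fun k => ∑ i ∈ s, V i k) W = ∑ i ∈ s, pair h u φ ψ p (V i) W := by
  unfold pair
  rw [Finset.sum_comm]
  simp only [Finset.mul_sum, Finset.sum_mul]
  rw [Finset.sum_comm]
  conv_rhs => rw [Finset.sum_comm]
  refine Finset.sum_congr rfl fun k _ => ?_
  rw [Finset.sum_comm]

section Smooth

variable (hu : ContMDiff (𝓘(ℝ, ℝ).prod (𝓡 d)) (𝓡 n) ∞ u)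
  (hφ : φ ∈ IsManifold.maximalAtlas (𝓡 d) ∞ M) (hψ : ψ ∈ IsManifold.maximalAtlas (𝓡 n) ∞ N)
  (hp : p ∈ coordDomain u φ ψ)
include hu hφ hψ hp

lemma contDiffAt_pullMetric (k l : Fin n) :
    ContDiffAt ℝ ∞ (fun p => metricCoeff h ψ (ψ (pull u φ p)) k l) p :=
  ContDiffAt.comp (g := fun y => metricCoeff h ψ y k l) (f := fun p => ψ (pull u φ p)) p
    (contDiffAt_metricCoeff h hψ (ψ.map_source hp.2) k l) (contDiffAt_chart_pull hu hφ hψ hp)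

lemma contDiffAt_du (α : Fin (d + 1)) (k : Fin n) :
    ContDiffAt ℝ ∞ (fun p => du u φ ψ α p k) p :=
  ((contDiffAt_euclidean.1 (contDiffAt_chart_pull hu hφ hψ hp)) k).pd

lemma contDiffAt_connMatrix (α : Fin (d + 1)) (k j : Fin n) :
    ContDiffAt ℝ ∞ (fun p => connMatrix h u φ ψ α p k j) p := by
  unfold connMatrix
  refine ContDiffAt.sum fun i _ => ContDiffAt.mul ?_ (contDiffAt_du hu hφ hψ hp α i)
  exact ContDiffAt.comp (g := christoffel _ (metricCoeff h ψ) k i j)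
    (f := fun p => ψ (pull u φ p)) p (contDiffAt_christoffel
      (fun i j => contDiffAt_metricCoeff h hψ (ψ.map_source hp.2) i j)
      (det_metricCoeff_ne_zero h hψ (ψ.map_source hp.2)) k i j)
    (contDiffAt_chart_pull hu hφ hψ hp)

lemma contDiffAt_covD {V : ℝ × EuclideanSpace ℝ (Fin d) → Fin n → ℝ}
    (hV : ∀ k, ContDiffAt ℝ ∞ (fun p => V p k) p) (α : Fin (d + 1)) (k : Fin n) :
    ContDiffAt ℝ ∞ (fun p => covD h u φ ψ α V p k) p := by
  simp only [covD_eq]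
  exact (hV k).pd.add (ContDiffAt.sum fun j _ =>
    (contDiffAt_connMatrix hu hφ hψ hp α k j).mul (hV j))

lemma contDiffAt_pair {V W : ℝ × EuclideanSpace ℝ (Fin d) → Fin n → ℝ}
    (hV : ∀ k, ContDiffAt ℝ ∞ (fun p => V p k) p) (hW : ∀ k, ContDiffAt ℝ ∞ (fun p => W p k) p) :
    ContDiffAt ℝ ∞ (fun p => pair h u φ ψ p (V p) (W p)) p :=
  ContDiffAt.sum fun k _ => ContDiffAt.sum fun l _ =>
    ((contDiffAt_pullMetric hu hφ hψ hp k l).mul (hV k)).mul (hW l)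

/-- The chain rule reduces this to compatibility of the Christoffel symbols of `h` at the image
point, contracted with ∂_α u. -/
lemma pd_pullMetric (α : Fin (d + 1)) (k l : Fin n) :
    pd (dir d α) (fun p => metricCoeff h ψ (ψ (pull u φ p)) k l) p
      = ∑ s, (connMatrix h u φ ψ α p s k * metricCoeff h ψ (ψ (pull u φ p)) s l
        + metricCoeff h ψ (ψ (pull u φ p)) k s * connMatrix h u φ ψ α p s l) := by
  have hG := contDiffAt_metricCoeff h hψ (ψ.map_source hp.2)
  have h0 := det_metricCoeff_ne_zero h hψ (ψ.map_source hp.2)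
  rw [pd_comp (contDiffAt_chart_pull hu hφ hψ hp).diff (hG k l).diff]
  simp only [pd_metric (b := fun i : Fin n => EuclideanSpace.single i (1 : ℝ))
    (metricCoeff_symm h) h0, connMatrix, Finset.sum_mul, Finset.mul_sum]
  rw [Finset.sum_comm]
  refine Finset.sum_congr rfl fun s _ => ?_
  rw [← Finset.sum_add_distrib]
  refine Finset.sum_congr rfl fun m _ => ?_
  unfold du
  ring

/-- The pull-back connection is compatible with the metric. -/
lemma pd_pair {V W : ℝ × EuclideanSpace ℝ (Fin d) → Fin n → ℝ}
    (hV : ∀ k, ContDiffAt ℝ ∞ (fun p => V p k) p) (hW : ∀ k, ContDiffAt ℝ ∞ (fun p => W p k) p)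
    (α : Fin (d + 1)) :
    pd (dir d α) (fun p => pair h u φ ψ p (V p) (W p)) p
      = pair h u φ ψ p (covD h u φ ψ α V p) (W p) + pair h u φ ψ p (V p) (covD h u φ ψ α W p) := by
  have hH := contDiffAt_pullMetric (h := h) hu hφ hψ hp
  set H : Fin n → Fin n → ℝ := fun k l => metricCoeff h ψ (ψ (pull u φ p)) k l with hHdef
  set Ω := connMatrix h u φ ψ α p with hΩ
  have h1 : ∀ k l, pd (dir d α) (fun p => metricCoeff h ψ (ψ (pull u φ p)) k l * V p k * W p l) p
      = (∑ s, (Ω s k * H s l + H k s * Ω s l)) * V p k * W p l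
        + H k l * pd (dir d α) (fun p => V p k) p * W p l
        + H k l * V p k * pd (dir d α) (fun p => W p l) p := by
    intro k l
    rw [pd_mul ((hH k l).mul (hV k)).diff (hW l).diff, pd_mul (hH k l).diff (hV k).diff,
      pd_pullMetric hu hφ hψ hp]
    ring
  have h2 : pd (dir d α) (fun p => pair h u φ ψ p (V p) (W p)) p
      = ∑ k, ∑ l, pd (dir d α)
        (fun p => metricCoeff h ψ (ψ (pull u φ p)) k l * V p k * W p l) p := by
    unfold pair
    rw [pd_sum fun k _ => (ContDiffAt.sum fun l _ => ((hH k l).mul (hV k)).mul (hW l)).diff]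
    refine Finset.sum_congr rfl fun k _ => ?_
    rw [pd_sum fun l _ => (((hH k l).mul (hV k)).mul (hW l)).diff]
  rw [h2]
  simp only [h1, Finset.sum_add_distrib, pair, covD_eq, mul_add, add_mul, ← hΩ, Finset.sum_mul,
    Finset.mul_sum]
  -- The two halves of the derivative of the metric are, after renaming indices, the connection
  -- terms of D_α V and of D_α W.
  have h3 : ∑ k, ∑ l, ∑ s, Ω s k * H s l * V p k * W p l
      = ∑ k, ∑ l, ∑ j, H k l * (Ω k j * V p j) * W p l := by
    rw [Finset.sum_comm]
    conv_rhs => rw [Finset.sum_comm]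
    refine Finset.sum_congr rfl fun l _ => ?_
    rw [Finset.sum_comm]
    exact Finset.sum_congr rfl fun k _ => Finset.sum_congr rfl fun j _ => by ring
  have h4 : ∑ k, ∑ l, ∑ s, H k s * Ω s l * V p k * W p l
      = ∑ k, ∑ l, ∑ j, H k l * V p k * (Ω l j * W p j) := by
    refine Finset.sum_congr rfl fun k _ => ?_
    rw [Finset.sum_comm]
    exact Finset.sum_congr rfl fun l _ => Finset.sum_congr rfl fun j _ => by ring
  rw [h3, h4]
  ring

/-- The pull-back connection is torsion free. -/
lemma covD_du_symm (α β : Fin (d + 1)) (k : Fin n) :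
    covD h u φ ψ α (du u φ ψ β) p k = covD h u φ ψ β (du u φ ψ α) p k := by
  unfold covD
  congr 1
  · exact pd_comm ((contDiffAt_euclidean.1 (contDiffAt_chart_pull hu hφ hψ hp)) k)
  · rw [Finset.sum_comm]
    refine Finset.sum_congr rfl fun i _ => Finset.sum_congr rfl fun j _ => ?_
    rw [christoffel_symm (metricCoeff_symm h)]
    ring

end Smooth

lemma covD_sum_mul {ι : Type*} (s : Finset ι) {f : ι → ℝ × EuclideanSpace ℝ (Fin d) → ℝ}
    {V : ι → ℝ × EuclideanSpace ℝ (Fin d) → Fin n → ℝ}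
    (hf : ∀ i, DifferentiableAt ℝ (f i) p) (hV : ∀ i k, DifferentiableAt ℝ (fun p => V i p k) p)
    (α : Fin (d + 1)) (k : Fin n) :
    covD h u φ ψ α (fun p l => ∑ i ∈ s, f i p * V i p l) p k
      = ∑ i ∈ s, (pd (dir d α) (f i) p * V i p k + f i p * covD h u φ ψ α (V i) p k) := by
  simp only [covD_eq]
  rw [pd_sum fun i _ => (hf i).fun_mul (hV i k),
    Finset.sum_congr rfl fun i _ => pd_mul (hf i) (hV i k)]
  simp only [mul_add, Finset.sum_add_distrib, Finset.mul_sum]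
  rw [Finset.sum_comm (s := Finset.univ), add_assoc]
  congr 2
  exact Finset.sum_congr rfl fun i _ => Finset.sum_congr rfl fun j _ => by ring

end PullbackConnection

/-! ### The product Lorentz metric and the left-hand side. -/

section Lorentz

/-- The block matrix `diag(-1, A)`. -/
def lorentzBlock {d : ℕ} (A : Matrix (Fin d) (Fin d) ℝ) : Matrix (Fin (d + 1)) (Fin (d + 1)) ℝ :=
  Matrix.of (Fin.cons (Fin.cons (-1) 0) (fun i => Fin.cons 0 (A i)))

section Block

variable {d : ℕ} (A : Matrix (Fin d) (Fin d) ℝ)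

@[simp] lemma lorentzBlock_zero_zero : lorentzBlock A 0 0 = -1 := rfl

@[simp] lemma lorentzBlock_zero_succ (j : Fin d) : lorentzBlock A 0 j.succ = 0 := rfl

@[simp] lemma lorentzBlock_succ_zero (i : Fin d) : lorentzBlock A i.succ 0 = 0 := rfl

@[simp] lemma lorentzBlock_succ_succ (i j : Fin d) : lorentzBlock A i.succ j.succ = A i j := rfl

lemma det_lorentzBlock : (lorentzBlock A).det = - A.det := by
  rw [Matrix.det_succ_row_zero, Fin.sum_univ_succ]
  simp only [lorentzBlock_zero_succ, lorentzBlock_zero_zero, mul_zero, zero_mul,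
    Finset.sum_const_zero, add_zero, Fin.val_zero, pow_zero, one_mul, neg_one_mul, neg_inj]
  congr 1

variable {A}

lemma inv_lorentzBlock (hA : A.det ≠ 0) : (lorentzBlock A)⁻¹ = lorentzBlock A⁻¹ := by
  apply Matrix.inv_eq_right_inv
  have h := Matrix.mul_nonsing_inv A (isUnit_iff_ne_zero.2 hA)
  ext i j
  rw [Matrix.mul_apply, Fin.sum_univ_succ]
  induction i using Fin.cases with
  | zero =>
    induction j using Fin.cases with
    | zero => simp
    | succ j => simp [(Fin.succ_ne_zero j).symm]
  | succ i =>
    induction j using Fin.cases with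
    | zero => simp [Fin.succ_ne_zero]
    | succ j =>
      simp only [lorentzBlock_succ_zero, lorentzBlock_zero_succ, lorentzBlock_succ_succ, mul_zero,
        zero_add]
      rw [← Matrix.mul_apply, h, Matrix.one_apply, Matrix.one_apply]
      simp

end Block

variable {d : ℕ} {M : Type*} [TopologicalSpace M] [ChartedSpace (EuclideanSpace ℝ (Fin d)) M]
  [IsManifold (𝓡 d) ∞ M] (g : RiemMetric d M)
  {φ : OpenPartialHomeomorph M (EuclideanSpace ℝ (Fin d))}
  {p : ℝ × EuclideanSpace ℝ (Fin d)}

lemma lorentzCoeff_eq (p : ℝ × EuclideanSpace ℝ (Fin d)) :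
    lorentzCoeff g φ p = lorentzBlock (metricCoeff g φ p.2) := rfl

lemma lorentzCoeff_symm (p : ℝ × EuclideanSpace ℝ (Fin d)) (i j : Fin (d + 1)) :
    lorentzCoeff g φ p i j = lorentzCoeff g φ p j i := by
  rw [lorentzCoeff_eq]
  induction i using Fin.cases <;> induction j using Fin.cases <;> simp
  exact metricCoeff_symm g _ _ _

lemma pd_time_eq_zero {f : EuclideanSpace ℝ (Fin d) → ℝ} :
    pd (dir d 0) (fun p => f p.2) p = 0 := by
  unfold pd
  by_cases hf : DifferentiableAt ℝ (fun p : ℝ × EuclideanSpace ℝ (Fin d) => f p.2) p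
  · rw [← hf.lineDeriv_eq_fderiv]
    simp [lineDeriv, dir]
  -- Without differentiability the derivative has the default value zero, so no regularity of `f` is
  -- required.
  · rw [fderiv_zero_of_not_differentiableAt hf]; rfl

section Smooth

variable (hφ : φ ∈ IsManifold.maximalAtlas (𝓡 d) ∞ M) (hp : p.2 ∈ φ.target)
include hφ hp

lemma det_lorentzCoeff_ne_zero : (lorentzCoeff g φ p).det ≠ 0 := by
  rw [lorentzCoeff_eq, det_lorentzBlock]
  exact neg_ne_zero.2 (det_metricCoeff_ne_zero g hφ hp)

lemma abs_det_lorentzCoeff :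
    |(lorentzCoeff g φ p).det| = |(metricCoeff g φ p.2).det| := by
  rw [lorentzCoeff_eq, det_lorentzBlock, abs_neg]

lemma inv_lorentzCoeff : (lorentzCoeff g φ p)⁻¹ = lorentzBlock (metricCoeff g φ p.2)⁻¹ := by
  rw [lorentzCoeff_eq, inv_lorentzBlock (det_metricCoeff_ne_zero g hφ hp)]

lemma eventually_mem_target : ∀ᶠ p' : ℝ × EuclideanSpace ℝ (Fin d) in nhds p, p'.2 ∈ φ.target :=
  continuousAt_snd.eventually_mem (φ.open_target.mem_nhds hp)

lemma contDiffAt_lorentzCoeff (i j : Fin (d + 1)) :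
    ContDiffAt ℝ ∞ (fun p => lorentzCoeff g φ p i j) p := by
  simp only [lorentzCoeff_eq]
  induction i using Fin.cases <;> induction j using Fin.cases <;> simp only
    [lorentzBlock_zero_zero, lorentzBlock_zero_succ, lorentzBlock_succ_zero, lorentzBlock_succ_succ]
  · exact contDiffAt_const
  · exact contDiffAt_const
  · exact contDiffAt_const
  · exact ContDiffAt.comp (g := fun y => metricCoeff g φ y _ _) (f := Prod.snd) p
      (contDiffAt_metricCoeff g hφ hp _ _) contDiffAt_snd

lemma pd_time_lorentzCoeff (i j : Fin (d + 1)) :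
    pd (dir d 0) (fun p => lorentzCoeff g φ p i j) p = 0 :=
  pd_time_eq_zero (f := fun y => lorentzBlock (metricCoeff g φ y) i j)

lemma pd_lorentzCoeff_zero_left (v : ℝ × EuclideanSpace ℝ (Fin d)) (j : Fin (d + 1)) :
    pd v (fun p => lorentzCoeff g φ p 0 j) p = 0 := by
  simp only [lorentzCoeff_eq]
  induction j using Fin.cases <;> simp [pd_const]

lemma pd_lorentzCoeff_zero_right (v : ℝ × EuclideanSpace ℝ (Fin d)) (j : Fin (d + 1)) :
    pd v (fun p => lorentzCoeff g φ p j 0) p = 0 := by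
  simp only [lorentzCoeff_eq]
  induction j using Fin.cases <;> simp [pd_const]

/-- Row zero of the inverse metric meets only the column zero, and what remains are derivatives of
the constant coefficients η_{0β}, η_{α0} and time derivatives of a static metric. -/
lemma stChristoffel_zero_upper (α β : Fin (d + 1)) : stChristoffel g φ 0 α β p = 0 := by
  unfold stChristoffel christoffel
  rw [inv_lorentzCoeff g hφ hp, Fin.sum_univ_succ, pd_time_lorentzCoeff g hφ hp,
    pd_lorentzCoeff_zero_left g hφ hp, pd_lorentzCoeff_zero_right g hφ hp]
  simp

lemma stChristoffel_zero_left (σ β : Fin (d + 1)) : stChristoffel g φ σ 0 β p = 0 := by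
  unfold stChristoffel christoffel
  simp [pd_time_lorentzCoeff g hφ hp, pd_lorentzCoeff_zero_left g hφ hp]

lemma stChristoffel_zero_right (σ α : Fin (d + 1)) : stChristoffel g φ σ α 0 p = 0 := by
  unfold stChristoffel christoffel
  simp [pd_time_lorentzCoeff g hφ hp, pd_lorentzCoeff_zero_right g hφ hp]

/-- Stated on a neighbourhood, not just at `p`, because the contracted symbols are differentiated in
the zeroth-order term. -/
lemma contracted_lorentz_eventually (k : Fin d) :
    contracted (dir d) (lorentzCoeff g φ) k.succ =ᶠ[nhds p] fun p =>
      ∑ i : Fin d, ∑ j : Fin d, (metricCoeff g φ p.2)⁻¹ i j *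
        stChristoffel g φ k.succ i.succ j.succ p := by
  filter_upwards [eventually_mem_target hφ hp] with p' hp'
  unfold contracted
  rw [inv_lorentzCoeff g hφ hp']
  change ∑ μ, ∑ ν, lorentzBlock (metricCoeff g φ p'.2)⁻¹ μ ν * stChristoffel g φ k.succ μ ν p' = _
  simp [Fin.sum_univ_succ, stChristoffel_zero_left g hφ hp', stChristoffel_zero_right g hφ hp']

lemma contracted_lorentz_zero_eventually :
    contracted (dir d) (lorentzCoeff g φ) 0 =ᶠ[nhds p] fun _ => 0 := by
  filter_upwards [eventually_mem_target hφ hp] with p' hp'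
  unfold contracted
  change ∑ μ, ∑ ν, _ * stChristoffel g φ 0 μ ν p' = _
  simp [stChristoffel_zero_upper g hφ hp']

lemma sum_contracted_mul (f : Fin d → ℝ) :
    ∑ k : Fin d, contracted (dir d) (lorentzCoeff g φ) k.succ p * f k
      = ∑ i : Fin d, ∑ j : Fin d, ∑ k : Fin d, (metricCoeff g φ p.2)⁻¹ i j *
        stChristoffel g φ k.succ i.succ j.succ p * f k := by
  simp only [fun k => (contracted_lorentz_eventually g hφ hp k).eq_of_nhds, Finset.sum_mul]
  rw [Finset.sum_comm]
  refine Finset.sum_congr rfl fun i _ => ?_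
  rw [Finset.sum_comm]

/-- The left hand side of the wave equation in space-time notation. -/
lemma waveLHSExpanded_eq (θ : Fin (d + 1) → ℝ × EuclideanSpace ℝ (Fin d) → ℝ) (γ : Fin (d + 1)) :
    waveLHSExpanded g φ θ γ p
      = - (∑ α, ∑ β, (lorentzCoeff g φ p)⁻¹ α β * pd (dir d α) (pd (dir d β) (θ γ)) p)
        + (∑ σ, contracted (dir d) (lorentzCoeff g φ) σ p * pd (dir d σ) (θ γ) p)
        + 2 * (∑ α, ∑ β, ∑ σ, (lorentzCoeff g φ p)⁻¹ α β * stChristoffel g φ σ β γ p *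
            pd (dir d α) (θ σ) p)
        + ∑ σ, pd (dir d γ) (contracted (dir d) (lorentzCoeff g φ) σ) p * θ σ p := by
  have h1 : ∑ σ, contracted (dir d) (lorentzCoeff g φ) σ p * pd (dir d σ) (θ γ) p
      = ∑ i : Fin d, ∑ j : Fin d, ∑ k : Fin d, (metricCoeff g φ p.2)⁻¹ i j *
        stChristoffel g φ k.succ i.succ j.succ p * pd (dir d k.succ) (θ γ) p := by
    rw [Fin.sum_univ_succ, (contracted_lorentz_zero_eventually g hφ hp).eq_of_nhds, zero_mul,
      zero_add, sum_contracted_mul g hφ hp]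
  have h2 : ∑ σ, pd (dir d γ) (contracted (dir d) (lorentzCoeff g φ) σ) p * θ σ p
      = ∑ k : Fin d, pd (dir d γ) (fun p' => ∑ i : Fin d, ∑ j : Fin d,
      (metricCoeff g φ p'.2)⁻¹ i j * stChristoffel g φ k.succ i.succ j.succ p') p * θ k.succ p := by
    rw [Fin.sum_univ_succ, pd_congr (contracted_lorentz_zero_eventually g hφ hp), pd_const,
      zero_mul, zero_add]
    exact Finset.sum_congr rfl fun k _ => by rw [pd_congr (contracted_lorentz_eventually g hφ hp k)]
  rw [h1, h2, inv_lorentzCoeff g hφ hp]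
  unfold waveLHSExpanded lowerOrder
  -- The time-time entry -1 of the inverse metric, with the minus sign in front of the double sum,
  -- yields the second time derivative; all other time contributions vanish.
  simp only [Fin.sum_univ_succ, lorentzBlock_zero_zero, lorentzBlock_zero_succ,
    lorentzBlock_succ_zero, lorentzBlock_succ_succ, stChristoffel_zero_upper g hφ hp,
    stChristoffel_zero_left g hφ hp, mul_zero, zero_mul, zero_add, add_zero,
    Finset.sum_const_zero]
  ring

/-- Since |det η| = |det g|, the density of g can be replaced by that of η, so the divergence
identity for the inverse Lorentz metric supplies the first-order term. -/
lemma laplaceBeltrami_eq {f : ℝ × EuclideanSpace ℝ (Fin d) → ℝ} (hf : ContDiffAt ℝ ∞ f p) :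
    laplaceBeltrami g φ f p
      = (∑ i : Fin d, ∑ j : Fin d, (metricCoeff g φ p.2)⁻¹ i j *
          pd (dir d i.succ) (pd (dir d j.succ) f) p)
        - ∑ k : Fin d, contracted (dir d) (lorentzCoeff g φ) k.succ p * pd (dir d k.succ) f p := by
  have hL := contDiffAt_lorentzCoeff g hφ hp
  have h0 := det_lorentzCoeff_ne_zero g hφ hp
  set s : ℝ × EuclideanSpace ℝ (Fin d) → ℝ := fun p => Real.sqrt |(lorentzCoeff g φ p).det| with hs
  have hsd : ContDiffAt ℝ ∞ s p := contDiffAt_sqrt_abs (contDiffAt_det hL) h0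
  have hs0 : s p ≠ 0 := (Real.sqrt_pos.2 (abs_pos.2 h0)).ne'
  set c : Fin (d + 1) → Fin (d + 1) → ℝ × EuclideanSpace ℝ (Fin d) → ℝ :=
    fun α β p => s p * (lorentzCoeff g φ p)⁻¹ α β with hc
  have hcd : ∀ α β, ContDiffAt ℝ ∞ (c α β) p := fun α β => hsd.mul (contDiffAt_inv hL h0 α β)
  have hcon : ∀ j : Fin d, ∑ i : Fin d, pd (dir d i.succ) (c i.succ j.succ) p
      = - (s p * contracted (dir d) (lorentzCoeff g φ) j.succ p) := by
    intro j
    have h := sum_pd_sqrt_det_mul_inv (b := dir d) (lorentzCoeff_symm g) hL h0 j.succ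
    rw [Fin.sum_univ_succ] at h
    -- The divergence identity sums over time as well; that term drops because η^{0j} = 0 near `p`.
    have hz : (fun p => Real.sqrt |(lorentzCoeff g φ p).det| * (lorentzCoeff g φ p)⁻¹ 0 j.succ)
        =ᶠ[nhds p] fun _ => 0 := by
      filter_upwards [eventually_mem_target hφ hp] with p' hp'
      rw [inv_lorentzCoeff g hφ hp']
      simp
    rw [pd_congr hz, pd_const, zero_add] at h
    exact h
  have hfun : ∀ i : Fin d, (fun p' : ℝ × EuclideanSpace ℝ (Fin d) =>
      Real.sqrt |(metricCoeff g φ p'.2).det| *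
        ∑ j : Fin d, (metricCoeff g φ p'.2)⁻¹ i j * pd (dir d j.succ) f p') =ᶠ[nhds p]
      fun p' => ∑ j : Fin d, c i.succ j.succ p' * pd (dir d j.succ) f p' := by
    intro i
    filter_upwards [eventually_mem_target hφ hp] with p' hp'
    simp only [hc, hs]
    rw [inv_lorentzCoeff g hφ hp', abs_det_lorentzCoeff g hφ hp', Finset.mul_sum]
    exact Finset.sum_congr rfl fun j _ => by rw [lorentzBlock_succ_succ, mul_assoc]
  have hpd : ∀ i : Fin d, pd (dir d i.succ) (fun p' : ℝ × EuclideanSpace ℝ (Fin d) =>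
      Real.sqrt |(metricCoeff g φ p'.2).det| *
        ∑ j : Fin d, (metricCoeff g φ p'.2)⁻¹ i j * pd (dir d j.succ) f p') p
      = ∑ j : Fin d, (pd (dir d i.succ) (c i.succ j.succ) p * pd (dir d j.succ) f p
        + s p * ((metricCoeff g φ p.2)⁻¹ i j * pd (dir d i.succ) (pd (dir d j.succ) f) p)) := by
    intro i
    rw [pd_congr (hfun i), pd_sum fun j _ => ((hcd _ _).mul hf.pd).diff]
    refine Finset.sum_congr rfl fun j _ => ?_
    rw [pd_mul (hcd _ _).diff hf.pd.diff]
    simp only [hc]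
    rw [inv_lorentzCoeff g hφ hp, lorentzBlock_succ_succ, mul_assoc]
  unfold laplaceBeltrami
  have hs1 : Real.sqrt |(metricCoeff g φ p.2).det| = s p := by
    rw [hs]; simp only; rw [abs_det_lorentzCoeff g hφ hp]
  rw [Finset.sum_congr rfl fun i _ => hpd i, hs1]
  simp only [Finset.sum_add_distrib, ← Finset.mul_sum]
  rw [Finset.sum_comm]
  simp only [← Finset.sum_mul, hcon, neg_mul, mul_assoc, Finset.sum_neg_distrib, ← Finset.mul_sum]
  field_simp
  ring

lemma waveLHS_eq_waveLHSExpanded {θ : Fin (d + 1) → ℝ × EuclideanSpace ℝ (Fin d) → ℝ}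
    {γ : Fin (d + 1)} (hθ : ContDiffAt ℝ ∞ (θ γ) p) :
    waveLHS g φ θ γ p = waveLHSExpanded g φ θ γ p := by
  unfold waveLHS waveLHSExpanded
  rw [laplaceBeltrami_eq g hφ hp hθ, sum_contracted_mul g hφ hp]
  ring

end Smooth

end Lorentz

/-! ### The pointwise index algebra of the wave equation. -/

section Algebra

variable {ι V : Type*} [Fintype ι] [AddCommGroup V] [Module ℝ V]

/-- The pointwise algebra behind the wave equation. Here `Q α β` stands for `∂_α q_β`, `B α β` for
`∂_α A_β`, `Q₂ α β` for `∂_α ∂_β q_γ` and `R α β` for `∂_γ ∂_α q_β`. -/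
lemma wave_algebra {I dI : ι → ι → ℝ} {Γ : ι → ι → ι → ℝ} {Λ dΛ : ι → ℝ} {q : ι → V}
    {Q Q₂ R : ι → ι → V} {A : ι → V →ₗ[ℝ] V} {B : ι → ι → V →ₗ[ℝ] V} {γ : ι}
    (hI : ∀ α β, I α β = I β α) (hΓ : ∀ σ α β, Γ σ α β = Γ σ β α)
    (hΛ : ∀ σ, Λ σ = ∑ α, ∑ β, I α β * Γ σ α β)
    (hdI : ∀ α β, dI α β = - ∑ k, (I α k * Γ β γ k + Γ α γ k * I k β))
    (hS : ∀ α β, Q α β + A α (q β) = Q β α + A β (q α))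
    (hW : ∑ α, ∑ β, I α β • (Q α β + A α (q β)) = ∑ σ, Λ σ • q σ)
    (hR : ∀ α β, R α β = Q₂ α β + B α β (q γ) + A β (Q α γ) - B α γ (q β) - A γ (Q α β))
    (hD : ∑ α, ∑ β, (dI α β • (Q α β + A α (q β))
        + I α β • (R α β + B γ α (q β) + A α (Q γ β)))
      = ∑ σ, (dΛ σ • q σ + Λ σ • Q γ σ)) :
    - (∑ α, ∑ β, I α β • Q₂ α β) + (∑ σ, Λ σ • Q σ γ)
        + (2 : ℝ) • (∑ α, ∑ β, ∑ σ, (I α β * Γ σ β γ) • Q α σ) + ∑ σ, dΛ σ • q σ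
      = ∑ α, ∑ β, I α β • ((B γ α (q β) - B α γ (q β) + A γ (A α (q β)) - A α (A γ (q β)))
          + A α (A β (q γ)) + (B β α (q γ) - ∑ σ, Γ σ β α • A σ (q γ))
          + (2 : ℝ) • (A β (Q α γ) - ∑ σ, Γ σ α γ • A β (q σ))) := by
  have hsymm : ∀ f : ι → ι → V, ∑ α, ∑ β, I α β • f α β = ∑ α, ∑ β, I α β • f β α := by
    intro f
    rw [Finset.sum_comm]
    exact Finset.sum_congr rfl fun α _ => Finset.sum_congr rfl fun β _ => by rw [hI]
  have hQ : ∀ σ, Q γ σ = Q σ γ + A σ (q γ) - A γ (q σ) := fun σ => by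
    rw [← hS]; abel
  -- Both Christoffel terms of ∂_γ η^{αβ} contribute equally, because D_α q_β and η^{αβ} are
  -- symmetric; this is the origin of the factor 2.
  have e3 : ∑ α, ∑ β, dI α β • (Q α β + A α (q β))
      = - ((2 : ℝ) • ∑ α, ∑ β, ∑ σ, (I α β * Γ σ β γ) • (Q α σ + A α (q σ))) := by
    have h1 : ∑ α, ∑ β, ∑ k, (I α k * Γ β γ k) • (Q α β + A α (q β))
        = ∑ α, ∑ β, ∑ σ, (I α β * Γ σ β γ) • (Q α σ + A α (q σ)) := by
      refine Finset.sum_congr rfl fun α _ => ?_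
      rw [Finset.sum_comm]
      exact Finset.sum_congr rfl fun k _ => Finset.sum_congr rfl fun σ _ => by rw [hΓ σ k]
    have h2 : ∑ α, ∑ β, ∑ k, (Γ α γ k * I k β) • (Q α β + A α (q β))
        = ∑ α, ∑ β, ∑ σ, (I α β * Γ σ β γ) • (Q α σ + A α (q σ)) := by
      rw [Finset.sum_comm]
      refine Finset.sum_congr rfl fun β _ => ?_
      rw [Finset.sum_comm]
      exact Finset.sum_congr rfl fun k _ => Finset.sum_congr rfl fun σ _ => by
        rw [hΓ σ k, hI, hS, mul_comm]
    simp only [hdI, neg_smul, Finset.sum_smul, add_smul, Finset.sum_neg_distrib,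
      Finset.sum_add_distrib]
    rw [h1, h2, two_smul]
  have hγ : ∑ α, ∑ β, I α β • (A γ (Q α β) + A γ (A α (q β))) = ∑ σ, Λ σ • A γ (q σ) := by
    have := congrArg (A γ) hW
    simpa only [map_sum, map_smul, map_add] using this
  have hY : ∑ σ, Λ σ • A σ (q γ) = ∑ α, ∑ β, I α β • ∑ σ, Γ σ β α • A σ (q γ) := by
    simp only [hΛ, Finset.sum_smul, Finset.smul_sum, smul_smul]
    rw [Finset.sum_comm]
    refine Finset.sum_congr rfl fun α _ => ?_
    rw [Finset.sum_comm]
    exact Finset.sum_congr rfl fun β _ => Finset.sum_congr rfl fun σ _ => by rw [hΓ]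
  have hW3 : ∑ α, ∑ β, I α β • ∑ σ, Γ σ α γ • A β (q σ)
      = ∑ α, ∑ β, ∑ σ, (I α β * Γ σ β γ) • A α (q σ) := by
    rw [hsymm]
    simp only [Finset.smul_sum, smul_smul]
  have hU1 := hsymm fun α β => B β α (q γ)
  have hU2 := hsymm fun α β => A α (Q β γ)
  simp only [Finset.sum_add_distrib] at hD
  rw [e3] at hD
  have hc : ∀ α β (x : V), I α β • (2 : ℝ) • x = (2 : ℝ) • I α β • x := fun α β x => smul_comm _ _ _
  simp only [hR, hQ, map_add, map_sub, smul_add, smul_sub, hc, Finset.sum_add_distrib,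
    Finset.sum_sub_distrib] at hD hγ ⊢
  simp only [← Finset.smul_sum (r := (2 : ℝ))] at hD ⊢
  rw [← hY, hW3, hU1]
  rw [hU2] at hD
  -- `hD` is ∂_γ of the coclosedness equation and `hγ` is A_γ applied to it; their sum is its D_γ
  -- derivative, and the claim is the negative of that.
  linear_combination (norm := module) (-1 : ℝ) • hD + (-1 : ℝ) • hγ

end Algebra

/-! ### From covariantly closed and coclosed forms to the wave equation. -/

section Calculus

variable {X : Type*} [NormedAddCommGroup X] [NormedSpace ℝ X] {ι κ : Type*} [Fintype ι]
  [DecidableEq ι] [Fintype κ] [DecidableEq κ] {b : ι → X} {G : X → Matrix ι ι ℝ} {x : X}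

/-- The wave equation satisfied by scalar 1-forms `q a` which are covariantly closed and coclosed
for a connection form `A`. -/
theorem wave_equation_of_closed_of_coclosed (hs : ∀ y i j, G y i j = G y j i)
    (hG : ∀ i j, ContDiffAt ℝ ∞ (fun y => G y i j) x) (h0 : (G x).det ≠ 0)
    {q : κ → ι → X → ℝ} {A : κ → κ → ι → X → ℝ}
    (hq : ∀ a α, ContDiffAt ℝ ∞ (q a α) x) (hA : ∀ c a α, ContDiffAt ℝ ∞ (A c a α) x)
    (hclosed : ∀ᶠ y in nhds x, ∀ c α β,
      pd (b α) (q c β) y + ∑ a, A c a α y * q a β y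
        = pd (b β) (q c α) y + ∑ a, A c a β y * q a α y)
    (hcoclosed : ∀ᶠ y in nhds x, ∀ c,
      ∑ α, ∑ β, (G y)⁻¹ α β * (pd (b α) (q c β) y + ∑ a, A c a α y * q a β y)
        = ∑ σ, contracted b G σ y * q c σ y) (γ : ι) (c : κ) :
    - (∑ α, ∑ β, (G x)⁻¹ α β * pd (b α) (pd (b β) (q c γ)) x)
        + (∑ σ, contracted b G σ x * pd (b σ) (q c γ) x)
        + 2 * (∑ α, ∑ β, ∑ σ, (G x)⁻¹ α β * christoffel b G σ β γ x * pd (b α) (q c σ) x)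
        + ∑ σ, pd (b γ) (contracted b G σ) x * q c σ x
      = ∑ α, ∑ β, (G x)⁻¹ α β *
        ((∑ a, (pd (b γ) (A c a α) x - pd (b α) (A c a γ) x
            + ∑ e, (A c e γ x * A e a α x - A c e α x * A e a γ x)) * q a β x)
          + (∑ e, ∑ a, A c e α x * A e a β x * q a γ x)
          + (∑ a, (pd (b β) (A c a α) x - ∑ σ, christoffel b G σ β α x * A c a σ x) * q a γ x)
          + 2 * ∑ a, A c a β x *
            (pd (b α) (q a γ) x - ∑ σ, christoffel b G σ α γ x * q a σ x)) := by
  have hI := contDiffAt_inv hG h0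
  have hAq : ∀ c α β, ContDiffAt ℝ ∞ (fun y => ∑ a, A c a α y * q a β y) x := fun c α β =>
    ContDiffAt.sum fun a _ => (hA c a α).mul (hq a β)
  have hpdAq : ∀ v c α β, pd v (fun y => ∑ a, A c a α y * q a β y) x
      = (∑ a, pd v (A c a α) x * q a β x) + ∑ a, A c a α x * pd v (q a β) x := by
    intro v c α β
    rw [pd_sum fun a _ => ((hA c a α).mul (hq a β)).diff, ← Finset.sum_add_distrib]
    exact Finset.sum_congr rfl fun a _ => pd_mul (hA c a α).diff (hq a β).diff
  let A' : ι → (κ → ℝ) →ₗ[ℝ] (κ → ℝ) := fun α => (Matrix.of fun c a => A c a α x).mulVecLin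
  let B' : ι → ι → (κ → ℝ) →ₗ[ℝ] (κ → ℝ) := fun v α =>
    (Matrix.of fun c a => pd (b v) (A c a α) x).mulVecLin
  have hA' : ∀ α w c, A' α w c = ∑ a, A c a α x * w a := fun α w c => rfl
  have hB' : ∀ v α w c, B' v α w c = ∑ a, pd (b v) (A c a α) x * w a := fun v α w c => rfl
  have main := wave_algebra (I := fun α β => (G x)⁻¹ α β)
    (dI := fun α β => pd (b γ) (fun y => (G y)⁻¹ α β) x)
    (Γ := fun σ α β => christoffel b G σ α β x) (Λ := fun σ => contracted b G σ x)
    (dΛ := fun σ => pd (b γ) (contracted b G σ) x) (q := fun σ a => q a σ x)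
    (Q := fun α β c => pd (b α) (q c β) x) (Q₂ := fun α β c => pd (b α) (pd (b β) (q c γ)) x)
    (R := fun α β c => pd (b γ) (pd (b α) (q c β)) x) (A := A') (B := B') (γ := γ)
    (inv_symm (hs x)) (fun σ α β => christoffel_symm hs σ α β) (fun σ => rfl)
    (fun α β => pd_inv_metric hs hG h0 γ α β)
    (fun α β => funext fun c => hclosed.self_of_nhds c α β)
    (by
      ext c
      simpa only [Finset.sum_apply, Pi.smul_apply, smul_eq_mul, Pi.add_apply, hA']
        using hcoclosed.self_of_nhds c)
    (by
      intro α β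
      ext c
      -- Closedness holds near `x`, so it may be differentiated once ∂_γ and ∂_α are exchanged.
      have h1 : pd (b γ) (q c β) =ᶠ[nhds x] fun y => pd (b β) (q c γ) y
          + (∑ a, A c a β y * q a γ y) - ∑ a, A c a γ y * q a β y := by
        filter_upwards [hclosed] with y hy
        rw [← hy c γ β]; ring
      rw [pd_comm (hq c β), pd_congr h1, pd_sub ((hq c γ).pd.add (hAq c β γ)).diff
        (hAq c γ β).diff, pd_add (hq c γ).pd.diff (hAq c β γ).diff, hpdAq, hpdAq]
      simp only [Pi.sub_apply, Pi.add_apply, hA', hB']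
      ring)
    (by
      ext c
      have h1 : (fun y => ∑ α, ∑ β, (G y)⁻¹ α β *
            (pd (b α) (q c β) y + ∑ a, A c a α y * q a β y))
          =ᶠ[nhds x] fun y => ∑ σ, contracted b G σ y * q c σ y := by
        filter_upwards [hcoclosed] with y hy using hy c
      have hΛ := contDiffAt_contracted (b := b) hG h0
      have hsm : ∀ α β, ContDiffAt ℝ ∞
          (fun y => pd (b α) (q c β) y + ∑ a, A c a α y * q a β y) x := fun α β =>
        (hq c β).pd.add (hAq c α β)
      have h2 := pd_congr (v := b γ) h1
      rw [pd_sum fun α _ => (ContDiffAt.sum fun β _ => (hI α β).mul (hsm α β)).diff,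
        pd_sum fun σ _ => ((hΛ σ).mul (hq c σ)).diff] at h2
      have h3 : ∀ α, pd (b γ) (fun y => ∑ β, (G y)⁻¹ α β *
            (pd (b α) (q c β) y + ∑ a, A c a α y * q a β y)) x
          = ∑ β, (pd (b γ) (fun y => (G y)⁻¹ α β) x *
              (pd (b α) (q c β) x + ∑ a, A c a α x * q a β x)
            + (G x)⁻¹ α β * (pd (b γ) (pd (b α) (q c β)) x
              + (∑ a, pd (b γ) (A c a α) x * q a β x) + ∑ a, A c a α x * pd (b γ) (q a β) x)) := by
        intro α
        rw [pd_sum fun β _ => ((hI α β).mul (hsm α β)).diff]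
        refine Finset.sum_congr rfl fun β _ => ?_
        rw [pd_mul (hI α β).diff (hsm α β).diff, pd_add (hq c β).pd.diff (hAq c α β).diff, hpdAq,
          add_assoc]
      simp only [h3, fun σ => pd_mul (v := b γ) (hΛ σ).diff (hq c σ).diff] at h2
      simpa only [Finset.sum_apply, Pi.smul_apply, smul_eq_mul, Pi.add_apply, hA', hB'] using h2)
  have hc := congrFun main c
  simp only [Finset.sum_apply, Pi.smul_apply, smul_eq_mul, Pi.add_apply, Pi.sub_apply, Pi.neg_apply,
    hA', hB'] at hc
  rw [hc]
  refine Finset.sum_congr rfl fun α _ => Finset.sum_congr rfl fun β _ => ?_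
  -- The composed operators are rewritten as matrix products, which form the commutator part of the
  -- curvature.
  have hcomp : ∀ α β β', ∑ a, A c a α x * ∑ a', A a a' β x * q a' β' x
      = ∑ a, (∑ e, A c e α x * A e a β x) * q a β' x := by
    intro α β β'
    simp only [Finset.mul_sum, Finset.sum_mul]
    rw [Finset.sum_comm]
    exact Finset.sum_congr rfl fun _ _ => Finset.sum_congr rfl fun _ _ => by ring
  have hcomp' : ∑ a, A c a α x * ∑ a', A a a' β x * q a' γ x
      = ∑ e, ∑ a, A c e α x * A e a β x * q a γ x := by
    simp only [Finset.mul_sum, mul_assoc]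
  have hΓA : ∑ σ, christoffel b G σ β α x * ∑ a, A c a σ x * q a γ x
      = ∑ a, (∑ σ, christoffel b G σ β α x * A c a σ x) * q a γ x := by
    simp only [Finset.mul_sum, Finset.sum_mul]
    rw [Finset.sum_comm]
    exact Finset.sum_congr rfl fun _ _ => Finset.sum_congr rfl fun _ _ => by ring
  have hΓq : ∑ σ, christoffel b G σ α γ x * ∑ a, A c a β x * q a σ x
      = ∑ a, A c a β x * ∑ σ, christoffel b G σ α γ x * q a σ x := by
    simp only [Finset.mul_sum]
    rw [Finset.sum_comm]
    exact Finset.sum_congr rfl fun _ _ => Finset.sum_congr rfl fun _ _ => by ring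
  rw [hcomp', hcomp, hcomp, hΓA, hΓq]
  simp only [add_mul, sub_mul, mul_sub, Finset.sum_add_distrib, Finset.sum_sub_distrib]
  ring

end Calculus

/-! ### Structure equations in the orthonormal frame. -/

section Frame

variable {d n : ℕ} {M : Type*} [TopologicalSpace M]
  [ChartedSpace (EuclideanSpace ℝ (Fin d)) M] [IsManifold (𝓡 d) ∞ M]
  {N : Type*} [TopologicalSpace N] [ChartedSpace (EuclideanSpace ℝ (Fin n)) N]
  [IsManifold (𝓡 n) ∞ N]
  {g : RiemMetric d M} {h : RiemMetric n N} {u : ℝ × M → N}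
  {e : Fin n → (z : ℝ × M) → TangentSpace (𝓡 n) (u z)}
  {φ : OpenPartialHomeomorph M (EuclideanSpace ℝ (Fin d))}
  {ψ : OpenPartialHomeomorph N (EuclideanSpace ℝ (Fin n))}
  {p : ℝ × EuclideanSpace ℝ (Fin d)}

lemma pair_eq_sum_frame (he : IsOrthonormalFrame (d := d) h u e)
    (hψ : ψ ∈ IsManifold.maximalAtlas (𝓡 n) ∞ N) (hp : p ∈ coordDomain u φ ψ)
    (V W : Fin n → ℝ) :
    pair h u φ ψ p V W = ∑ c, pair h u φ ψ p V (frameCoord u e φ ψ c p) *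
      pair h u φ ψ p W (frameCoord u e φ ψ c p) := by
  refine parseval_of_orthonormal (H := metricCoeff h ψ (ψ (pull u φ p)))
    (E := Matrix.of fun c k => frameCoord u e φ ψ c p k) (metricCoeff_symm h _) ?_ V W
  ext a b
  rw [Matrix.one_apply, ← pair_frameCoord he hψ hp a b]
  simp only [Matrix.mul_apply, Matrix.transpose_apply, Matrix.of_apply, pair, Finset.sum_mul]
  rw [Finset.sum_comm]
  exact Finset.sum_congr rfl fun k _ => Finset.sum_congr rfl fun l _ => by ring

variable (hu : ContMDiff (𝓘(ℝ, ℝ).prod (𝓡 d)) (𝓡 n) ∞ u)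
  (he : IsOrthonormalFrame (d := d) h u e)
  (hφ : φ ∈ IsManifold.maximalAtlas (𝓡 d) ∞ M) (hψ : ψ ∈ IsManifold.maximalAtlas (𝓡 n) ∞ N)
  (hp : p ∈ coordDomain u φ ψ)
include hu he hφ hψ hp

lemma q_eventually_eq (a : Fin n) (α : Fin (d + 1)) :
    q h u e φ a α =ᶠ[nhds p]
      fun p => pair h u φ ψ p (du u φ ψ α p) (frameCoord u e φ ψ a p) := by
  filter_upwards [coordDomain_mem_nhds hu hφ hp] with p' hp'
  exact q_eq_pair hu hφ hψ hp' a α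

lemma contDiffAt_q (a : Fin n) (α : Fin (d + 1)) : ContDiffAt ℝ ∞ (q h u e φ a α) p :=
  (contDiffAt_pair hu hφ hψ hp (contDiffAt_du hu hφ hψ hp α)
    (contDiffAt_frameCoord he hφ hψ hp a)).congr_of_eventuallyEq
    (q_eventually_eq hu he hφ hψ hp a α)

lemma contDiffAt_covD_frameCoord (a k : Fin n) (α : Fin (d + 1)) :
    ContDiffAt ℝ ∞ (fun p => covD h u φ ψ α (frameCoord u e φ ψ a) p k) p :=
  contDiffAt_covD hu hφ hψ hp (contDiffAt_frameCoord he hφ hψ hp a) α k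

lemma contDiffAt_connA (b a : Fin n) (α : Fin (d + 1)) :
    ContDiffAt ℝ ∞ (connA h u e φ ψ b a α) p :=
  contDiffAt_pair hu hφ hψ hp (fun k => contDiffAt_covD_frameCoord hu he hφ hψ hp a k α)
    (contDiffAt_frameCoord he hφ hψ hp b)

/-- The connection form of an orthonormal frame is skew-symmetric. -/
lemma connA_skew (b a : Fin n) (α : Fin (d + 1)) :
    connA h u e φ ψ b a α p = - connA h u e φ ψ a b α p := by
  have h1 : (fun p => pair h u φ ψ p (frameCoord u e φ ψ a p) (frameCoord u e φ ψ b p))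
      =ᶠ[nhds p] fun _ => if a = b then 1 else 0 := by
    filter_upwards [coordDomain_mem_nhds hu hφ hp] with p' hp'
    exact pair_frameCoord he hψ hp' a b
  have h2 := pd_congr (v := dir d α) h1
  rw [pd_const, pd_pair hu hφ hψ hp (contDiffAt_frameCoord he hφ hψ hp a)
    (contDiffAt_frameCoord he hφ hψ hp b), pair_comm (frameCoord u e φ ψ a p)] at h2
  exact eq_neg_of_add_eq_zero_left h2

/-- The frame components of `D_α ∂_β u` are `∂_α q_β + A_α q_β`. -/
lemma pair_covD_du (a : Fin n) (α β : Fin (d + 1)) :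
    pair h u φ ψ p (covD h u φ ψ α (du u φ ψ β) p) (frameCoord u e φ ψ a p)
      = pd (dir d α) (q h u e φ a β) p + ∑ b, connA h u e φ ψ a b α p * q h u e φ b β p := by
  rw [pd_congr (q_eventually_eq hu he hφ hψ hp a β), pd_pair hu hφ hψ hp
    (contDiffAt_du hu hφ hψ hp β) (contDiffAt_frameCoord he hφ hψ hp a),
    pair_eq_sum_frame he hψ hp (du u φ ψ β p), add_assoc, ← Finset.sum_add_distrib]
  symm
  rw [add_eq_left]
  -- Parseval turns the pairing of ∂_β u with D_α e_a into the sum of A^b_a q^b, while the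
  -- connection term carries A^a_b; skewness cancels them termwise.
  refine Finset.sum_eq_zero fun b _ => ?_
  rw [connA_skew hu he hφ hψ hp a b, q_eq_pair hu hφ hψ hp]
  unfold connA
  ring

/-- The structure equation `F = dA + A ∧ A`. -/
lemma curvF_eq (b a : Fin n) (α β : Fin (d + 1)) :
    curvF h u e φ ψ b a α β p
      = pd (dir d α) (connA h u e φ ψ b a β) p - pd (dir d β) (connA h u e φ ψ b a α) p
        + ∑ c, (connA h u e φ ψ b c α p * connA h u e φ ψ c a β p
          - connA h u e φ ψ b c β p * connA h u e φ ψ c a α p) := by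
  -- The same cancellation applied to D_β e_a in place of ∂_β u; antisymmetrising in α and β then
  -- gives the curvature.
  have key : ∀ α β, pair h u φ ψ p (covD h u φ ψ α (covD h u φ ψ β (frameCoord u e φ ψ a)) p)
      (frameCoord u e φ ψ b p) = pd (dir d α) (connA h u e φ ψ b a β) p
        + ∑ c, connA h u e φ ψ b c α p * connA h u e φ ψ c a β p := by
    intro α β
    have h1 := pd_pair (h := h) hu hφ hψ hp
      (fun k => contDiffAt_covD_frameCoord hu he hφ hψ hp a k β)
      (contDiffAt_frameCoord he hφ hψ hp b) α
    have h2 : pd (dir d α) (connA h u e φ ψ b a β) p = _ := h1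
    rw [h2, add_assoc, eq_comm, add_eq_left, pair_eq_sum_frame he hψ hp
      (covD h u φ ψ β (frameCoord u e φ ψ a) p), ← Finset.sum_add_distrib]
    refine Finset.sum_eq_zero fun c _ => ?_
    rw [connA_skew hu he hφ hψ hp b c]
    unfold connA
    ring
  unfold curvF
  rw [pair_sub_left, key, key, Finset.sum_sub_distrib]
  ring

/-- Torsion-freeness of the pull-back connection, read in the frame. -/
lemma frame_closed (a : Fin n) (α β : Fin (d + 1)) :
    pd (dir d α) (q h u e φ a β) p + ∑ b, connA h u e φ ψ a b α p * q h u e φ b β p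
      = pd (dir d β) (q h u e φ a α) p + ∑ b, connA h u e φ ψ a b β p * q h u e φ b α p := by
  rw [← pair_covD_du hu he hφ hψ hp, ← pair_covD_du hu he hφ hψ hp,
    funext (covD_du_symm hu hφ hψ hp α β)]

/-- The wave map equation, read in the frame: the Leibniz rule separates the divergence of √|η|
η^{αβ}, which is -√|η| Λ^β, and the density is divided out. -/
lemma frame_coclosed (hw : IsSmoothWaveMap g h u) (a : Fin n) :
    ∑ α, ∑ β, (lorentzCoeff g φ p)⁻¹ α β * (pd (dir d α) (q h u e φ a β) p
        + ∑ b, connA h u e φ ψ a b α p * q h u e φ b β p)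
      = ∑ σ, contracted (dir d) (lorentzCoeff g φ) σ p * q h u e φ a σ p := by
  have hL := contDiffAt_lorentzCoeff g hφ hp.1
  have h0 := det_lorentzCoeff_ne_zero g hφ hp.1
  set s : ℝ × EuclideanSpace ℝ (Fin d) → ℝ := fun p => Real.sqrt |(lorentzCoeff g φ p).det| with hs
  have hsd : ContDiffAt ℝ ∞ s p := contDiffAt_sqrt_abs (contDiffAt_det hL) h0
  have hs0 : s p ≠ 0 := (Real.sqrt_pos.2 (abs_pos.2 h0)).ne'
  have hc : ∀ α β, DifferentiableAt ℝ (fun p => s p * (lorentzCoeff g φ p)⁻¹ α β) p :=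
    fun α β => (hsd.mul (contDiffAt_inv hL h0 α β)).diff
  have h1 : ∀ k, ∑ α, ∑ β, (pd (dir d α) (fun p => s p * (lorentzCoeff g φ p)⁻¹ α β) p *
        du u φ ψ β p k + s p * (lorentzCoeff g φ p)⁻¹ α β *
        covD h u φ ψ α (du u φ ψ β) p k) = 0 := by
    intro k
    have h2 := hw.eq φ hφ ψ hψ p hp k
    have h3 := (mul_eq_zero.1 h2).resolve_left (one_div_ne_zero hs0)
    rw [← h3]
    refine Finset.sum_congr rfl fun α _ => ?_
    rw [← covD_sum_mul Finset.univ (hc α) fun β k => (contDiffAt_du hu hφ hψ hp β k).diff]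
    simp only [hs, Finset.mul_sum, mul_assoc]
  have h2 : ∑ α, ∑ β, (pd (dir d α) (fun p => s p * (lorentzCoeff g φ p)⁻¹ α β) p *
        q h u e φ a β p + s p * (lorentzCoeff g φ p)⁻¹ α β *
        (pd (dir d α) (q h u e φ a β) p + ∑ b, connA h u e φ ψ a b α p * q h u e φ b β p)) = 0 := by
    have h4 : pair h u φ ψ p (fun k => ∑ α, ∑ β,
        (pd (dir d α) (fun p => s p * (lorentzCoeff g φ p)⁻¹ α β) p *
        du u φ ψ β p k + s p * (lorentzCoeff g φ p)⁻¹ α β *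
        covD h u φ ψ α (du u φ ψ β) p k)) (frameCoord u e φ ψ a p) = 0 := by
      simp [h1, pair]
    rw [← h4, pair_sum_left]
    refine Finset.sum_congr rfl fun α _ => ?_
    rw [pair_sum_left]
    refine Finset.sum_congr rfl fun β _ => ?_
    rw [pair_add_left, pair_smul_left, pair_smul_left, pair_covD_du hu he hφ hψ hp,
      q_eq_pair hu hφ hψ hp]
  simp only [Finset.sum_add_distrib] at h2
  rw [Finset.sum_comm] at h2
  simp only [← Finset.sum_mul, mul_assoc, ← Finset.mul_sum] at h2
  have h5 : ∀ β, ∑ α, pd (dir d α) (fun p => s p * (lorentzCoeff g φ p)⁻¹ α β) p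
      = - (s p * contracted (dir d) (lorentzCoeff g φ) β p) := fun β =>
    sum_pd_sqrt_det_mul_inv (b := dir d) (lorentzCoeff_symm g) hL h0 β
  simp only [h5, neg_mul, mul_assoc, Finset.sum_neg_distrib, ← Finset.mul_sum] at h2
  have h6 := mul_left_cancel₀ hs0 (neg_add_eq_zero.1 h2)
  exact h6.symm

end Frame

end WaveMap

end

/-- The wave equation for the components of `du` in an orthonormal frame. It holds for every smooth
orthonormal frame of `u^*TN`, hence in particular for the Coulomb frame. -/
theorem mainTheorem6 {d n : ℕ}
    {M : Type*} [TopologicalSpace M] [ChartedSpace (EuclideanSpace ℝ (Fin d)) M]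
    [IsManifold (𝓡 d) ∞ M]
    {N : Type*} [TopologicalSpace N] [ChartedSpace (EuclideanSpace ℝ (Fin n)) N]
    [IsManifold (𝓡 n) ∞ N]
    (g : WaveMap.RiemMetric d M) (h : WaveMap.RiemMetric n N)
    (u : ℝ × M → N) (hu : WaveMap.IsSmoothWaveMap g h u)
    (e : Fin n → (z : ℝ × M) → TangentSpace (𝓡 n) (u z))
    (he : WaveMap.IsOrthonormalFrame (d := d) h u e)
    (φ : OpenPartialHomeomorph M (EuclideanSpace ℝ (Fin d)))
    (hφ : φ ∈ IsManifold.maximalAtlas (𝓡 d) ∞ M)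
    (ψ : OpenPartialHomeomorph N (EuclideanSpace ℝ (Fin n)))
    (hψ : ψ ∈ IsManifold.maximalAtlas (𝓡 n) ∞ N)
    (p : ℝ × EuclideanSpace ℝ (Fin d)) (hp : p ∈ WaveMap.coordDomain u φ ψ)
    (γ : Fin (d + 1)) (c : Fin n) :
    WaveMap.waveLHS g φ (WaveMap.q h u e φ c) γ p = WaveMap.waveRHS g h u e φ ψ c γ p ∧
    WaveMap.waveLHS g φ (WaveMap.q h u e φ c) γ p
      = WaveMap.waveLHSExpanded g φ (WaveMap.q h u e φ c) γ p := by
  have hq := fun a α => WaveMap.contDiffAt_q hu.smooth he hφ hψ hp a α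
  have hexp := WaveMap.waveLHS_eq_waveLHSExpanded g hφ hp.1 (θ := WaveMap.q h u e φ c) (hq c γ)
  refine ⟨?_, hexp⟩
  have hnhds := WaveMap.coordDomain_mem_nhds (ψ := ψ) hu.smooth hφ hp
  rw [hexp, WaveMap.waveLHSExpanded_eq g hφ hp.1]
  -- Both first-order equations hold at every nearby point because the coordinate domain is a
  -- neighbourhood of `p`, so they may be differentiated.
  refine (WaveMap.wave_equation_of_closed_of_coclosed (WaveMap.lorentzCoeff_symm g)
    (WaveMap.contDiffAt_lorentzCoeff g hφ hp.1) (WaveMap.det_lorentzCoeff_ne_zero g hφ hp.1) hq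
    (A := WaveMap.connA h u e φ ψ)
    (fun c a α => WaveMap.contDiffAt_connA hu.smooth he hφ hψ hp c a α)
    (hnhds.mono fun y hy c α β => WaveMap.frame_closed hu.smooth he hφ hψ hy c α β)
    (hnhds.mono fun y hy c => WaveMap.frame_coclosed hu.smooth he hφ hψ hy hu c) γ c).trans ?_
  simp only [WaveMap.waveRHS, WaveMap.curvF_eq hu.smooth he hφ hψ hp]
  rfl
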